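/- **Setting.** Let $\rho$ be a density operator on $L^2(\mathbb R)$ (non-negative, trace one), let $(Qf)(x)=xf(x)$, $Pf=-if'$, and let $W\in L^2(\mathbb R^2)$ be the Wigner function of $\rho$, i.e. the real function with Fourier transform $\widehat W(u,v)=\int W(q,p)e^{-i(uq+vp)}\,dq\,dp=\mathrm{Tr}(\rho\, e^{-iuQ-ivP})$. Let $p_\rho(\cdot\mid\theta)$ be the density of the quadrature $\cos\theta\, Q+\sin\theta\, P$ in the state $\rho$, i.e. $\int p_\rho(x\mid\theta)e^{itx}dx=\mathrm{Tr}(\rho\,e^{it(\cos\theta Q+\sin\theta P)})$ (equivalently, in Fourier form, $p_\rho$ is the Radon transform of $W$). One observes $n\ge 1$ i.i.d. variables $(X_i,\Phi_i)$ with density $p_\rho(x\mid\theta)/\pi$ on $\mathbb R\times[0,\pi)$, and $\mathbb P_n f=\frac1n\sum_{i=1}^n f(X_i,\Phi_i)$. Let $\varphi,\psi$ be the father and mother of an orthonormal wavelet basis of $L^2(\mathbb R)$, both $C^3$ with integrable derivatives of order $0,\dots,3$ (for instance compactly supported), $\int\psi=0$; write $f_{j,k}(x)=2^{j/2}f(2^jx-k)$.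 For $I=(j,k,e)$, $j\in\mathbb Z$, $k=(k_x,k_y)\in\mathbb Z^2$, $e\in\{0,1,2,3\}$, let $\Psi_I(x,y)$ be $\varphi_{j,k_x}(x)\varphi_{j,k_y}(y)$, $\varphi_{j,k_x}(x)\psi_{j,k_y}(y)$, $\psi_{j,k_x}(x)\varphi_{j,k_y}(y)$, $\psi_{j,k_x}(x)\psi_{j,k_y}(y)$ for $e=0,1,2,3$ respectively, and let $$\gamma_I(x,\theta)=\frac1{4\pi}\int_{-\infty}^{\infty}|u|\,\widehat\Psi_I(u\cos\theta,u\sin\theta)e^{ixu}\,du,\qquad B_e=\|\gamma_{(0,0,e)}\|_\infty .$$ Let $D\subset\mathbb R^2$ be bounded and $0\le j_1$, $j_0$ be integers (for instance $2^{j_1}\approx n^{1/7}$, $2^{j_0}\approx n/(\ln n)^2$). Let $\Lambda_0=\{(j_1,k,0):2^{-j_1}k\in D\}$, let $\Lambda_1=\{(j,k,e): e\in\{1,2,3\},\ j_1\le j<j_0,\ 2^{-j}k\in D\}$, and $\Lambda=\Lambda_0\cup\Lambda_1$. Let $E\subseteq\mathbb R^2$ be a measurable set which contains the supports of all $\Psi_I$,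 $I\in\Lambda$ ($E=\mathbb R^2$ is allowed), and let $W_E=W\mathbf 1_E$ be the Wigner function put to zero outside $E$. Let $(y_I)$ be real numbers with $\sum_{I\in\Lambda}e^{-y_I}=\sigma$, and put $x_I=2(j+\ln B_e)+y_I$. Let $\mathcal M$ be the set of all $m$ with $\Lambda_0\subseteq m\subseteq\Lambda$ and $x_I\le n$ for all $I\in m$. For $m\in\mathcal M$ let $\alpha_I=\mathbb P_n\gamma_I$, $\hat f_m=\sum_{I\in m}\alpha_I\Psi_I$, let $d(f,m)$ be the $L^2(\mathbb R^2)$-distance from $f$ to $\mathrm{span}(\Psi_I)_{I\in m}$, and for $\epsilon>0$, $\alpha\in(0,1)$ let $$\mathrm{pen}(m)=\frac{1+\epsilon}{n}\sum_{I\in m}2\left(\sqrt{\frac{2}{1-\alpha}x_I\Big(\mathbb P_n(\gamma_I^2)+\frac1n2^{2j}B_e^2\big(\tfrac13+\tfrac1\alpha\big)x_I\Big)}+\frac{2^jB_e}{3\sqrt n}x_I\right)^2 .$$ Let $\hat m$ be any minimizer over $m\in\mathcal M$ of $\gamma_n(\hat f_m)+\mathrm{pen}(m)$, where $\gamma_n(\sum_{I\in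 m}\tau_I\Psi_I)=\|\sum_{I\in m}\tau_I\Psi_I\|^2-2\sum_{I\in m}\tau_I\alpha_I$. **Theorem.** For all $\epsilon>0$ and $\alpha\in(0,1)$ there is a constant $C>0$, depending only on $\epsilon$ and $\alpha$, such that always $$\mathbb E\left[\left\{\frac{\epsilon}{2+\epsilon}\|W_E-\hat f_{\hat m}\|_2^2-\inf_{m\in\mathcal M}\Big(\big(1+\tfrac2\epsilon\big)d^2(W_E,m)+2\,\mathrm{pen}(m)\Big)\right\}\vee0\right]\le\frac{C\sigma}{n}+\frac{C}{n}2^{2j_1}.$$ Moreover, $y_I=2j$ is an admissible choice with $\sigma$ bounded independently of $n$, $j_1$, $j_0$: for every bounded $D$, $\sum_{I:\ j\ge0,\ 2^{-j}k\in D}e^{-2j}<\infty$. -/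

import Mathlib

open MeasureTheory ProbabilityTheory

noncomputable section

namespace QHT

/-! ### States, Wigner functions and homodyne data -/

/-- The Hilbert space `L²(ℝ; ℂ)`. -/
abbrev H : Type := Lp ℂ 2 (volume : Measure ℝ)

theorem weyl_memLp (u v : ℝ) (f : H) :
    MemLp (fun x : ℝ => Complex.exp (Complex.I * ((u * v / 2 + u * x : ℝ) : ℂ)) * f (x + v))
      2 (volume : Measure ℝ) := by
  have h1 : MemLp (fun x : ℝ => f (x + v)) 2 (volume : Measure ℝ) :=
    (Lp.memLp f).comp_measurePreserving (measurePreserving_add_right volume v)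
  refine h1.of_le ?_ ?_
  · refine AEStronglyMeasurable.mul ?_ h1.1
    exact (by fun_prop : Continuous fun x : ℝ =>
      Complex.exp (Complex.I * ((u * v / 2 + u * x : ℝ) : ℂ))).aestronglyMeasurable
  · filter_upwards with x
    rw [norm_mul, mul_comm Complex.I, Complex.norm_exp_ofReal_mul_I, one_mul]

/-- The unitary `exp(i(uQ + vP))` on `L²(ℝ)`, where `(Q f)(x) = x f(x)` and `P f = -i f'`; since
`[Q, P] = i` it is the map `f ↦ (x ↦ exp(i u v / 2) exp(i u x) f(x + v))`. -/
def weyl (u v : ℝ) (f : H) : H := (weyl_memLp u v f).toLp _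

/-- The index set of a fixed orthonormal basis of `L²(ℝ)`. -/
def basisSet : Set H := (exists_hilbertBasis ℂ H).choose

/-- A fixed orthonormal basis of `L²(ℝ)`. -/
def basis : HilbertBasis basisSet ℂ H := (exists_hilbertBasis ℂ H).choose_spec.choose

/-- The trace, computed in a fixed orthonormal basis (for non-negative operators and for
trace-class operators the value does not depend on the basis). -/
def opTrace (A : H → H) : ℂ := ∑' i, inner ℂ (basis i) (A (basis i))

/-- Density operators: non-negative (in particular self-adjoint) operators on `L²(ℝ)` with
trace one. A non-summable family has junk sum `0`, so trace one includes summability. -/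
def IsDensityOperator (ρ : H →L[ℂ] H) : Prop := ρ.IsPositive ∧ opTrace ρ = 1

/-- `(u, v) ↦ Tr(ρ exp(-iuQ - ivP))`. -/
def quantumCharFun (ρ : H →L[ℂ] H) (w : ℝ × ℝ) : ℂ :=
  opTrace fun f => ρ (weyl (-w.1) (-w.2) f)

/-- The two-dimensional Fourier transform `ĝ(w) = ∫ g(z) exp(-i ⟨w, z⟩) dz`. -/
def fourier2 (g : ℝ × ℝ → ℂ) (w : ℝ × ℝ) : ℂ :=
  ∫ z : ℝ × ℝ, g z * Complex.exp (-Complex.I * ((w.1 * z.1 + w.2 * z.2 : ℝ) : ℂ))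

/-- `W` is the Wigner function of `ρ`: the square-integrable real function whose Fourier transform
is `(u, v) ↦ Tr(ρ exp(-iuQ - ivP))`. The Fourier transform of `W ∈ L²` is expressed by duality:
`∫ W ĝ = ∫ Ŵ g` for all `g ∈ L¹ ∩ L²`. -/
structure IsWignerFunction (ρ : H →L[ℂ] H) (W : ℝ × ℝ → ℝ) : Prop where
  memLp : MemLp W 2 (volume : Measure (ℝ × ℝ))
  fourier : ∀ g : ℝ × ℝ → ℂ, Integrable g → MemLp g 2 (volume : Measure (ℝ × ℝ)) →
    ∫ z : ℝ × ℝ, (W z : ℂ) * fourier2 g z = ∫ w : ℝ × ℝ, quantumCharFun ρ w * g w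

/-- `p x φ = p_ρ(x | φ)` is the density at `x` of the measurement of the quadrature
`X_φ = cos φ Q + sin φ P` in the state `ρ`, i.e. `∫ p_ρ(x|φ) exp(itx) dx = Tr(ρ exp(itX_φ))`.
Together with the definition of the Wigner function this is the Fourier form
`F[p_ρ(·|φ)](t) = F₂W(t cos φ, t sin φ)` of the statement that `p_ρ` is the Radon transform
of `W`. (At `t = 0` the equation says that `p_ρ(·|φ)` is integrable with integral one.) -/
structure IsQuadratureDensity (ρ : H →L[ℂ] H) (p : ℝ → ℝ → ℝ) : Prop where
  measurable : Measurable fun z : ℝ × ℝ => p z.1 z.2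
  nonneg : ∀ x φ, 0 ≤ p x φ
  generating : ∀ φ ∈ Set.Ico 0 Real.pi, ∀ t : ℝ,
    ∫ x : ℝ, (p x φ : ℂ) * Complex.exp (Complex.I * ((t * x : ℝ) : ℂ)) =
      opTrace fun f => ρ (weyl (t * Real.cos φ) (t * Real.sin φ) f)

/-- The law of one observation `(X, Φ)`: `Φ` is uniform on `[0, π)` and, given `Φ = φ`, `X` has
density `p(· | φ)`; that is, density `p(x | φ) / π` on `ℝ × [0, π)`. -/
def dataLaw (p : ℝ → ℝ → ℝ) : Measure (ℝ × ℝ) :=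
  ((volume : Measure (ℝ × ℝ)).restrict (Set.univ ×ˢ Set.Ico 0 Real.pi)).withDensity
    fun z => ENNReal.ofReal (p z.1 z.2 / Real.pi)

/-! ### Wavelets -/

/-- `f_{j,k}(x) = 2^{j/2} f(2^j x - k)`. -/
def dilate (f : ℝ → ℝ) (j k : ℤ) (x : ℝ) : ℝ :=
  (2 : ℝ) ^ ((j : ℝ) / 2) * f ((2 : ℝ) ^ j * x - k)

/-- `φ` and `ψ` are the father and the mother of an orthonormal wavelet basis of `L²(ℝ)`. Both are
`C³` and localized, in the sense that the derivatives of order at most `3` are integrable (automatic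
for compact support). -/
structure IsWaveletPair (φ ψ : ℝ → ℝ) : Prop where
  contDiff_father : ContDiff ℝ 3 φ
  contDiff_mother : ContDiff ℝ 3 ψ
  integrable_father : ∀ i : ℕ, i ≤ 3 → Integrable (iteratedDeriv i φ)
  integrable_mother : ∀ i : ℕ, i ≤ 3 → Integrable (iteratedDeriv i ψ)
  mean_zero : ∫ x : ℝ, ψ x = 0
  orthonormal_mother : ∀ j k j' k' : ℤ,
    ∫ x : ℝ, dilate ψ j k x * dilate ψ j' k' x = if j = j' ∧ k = k' then 1 else 0
  complete_mother : ∀ f : ℝ → ℝ, MemLp f 2 (volume : Measure ℝ) →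
    (∀ j k : ℤ, ∫ x : ℝ, f x * dilate ψ j k x = 0) → f =ᵐ[volume] 0
  orthonormal_father : ∀ k k' : ℤ,
    ∫ x : ℝ, dilate φ 0 k x * dilate φ 0 k' x = if k = k' then 1 else 0
  /-- The `φ_{0,k}` and the `ψ_{j,k}`, `j < 0`, have the same closed linear span in `L²(ℝ)`
  (equivalently, the same orthogonal complement). -/
  span_father : ∀ f : ℝ → ℝ, MemLp f 2 (volume : Measure ℝ) →
    ((∀ k : ℤ, ∫ x : ℝ, f x * dilate φ 0 k x = 0) ↔
      ∀ j k : ℤ, j < 0 → ∫ x : ℝ, f x * dilate ψ j k x = 0)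

/-- Indices `I = (j, k, e)`: scale `j`, position `k = (k_x, k_y)`, type `e ∈ {0, 1, 2, 3}`. -/
abbrev WaveletIndex : Type := ℤ × (ℤ × ℤ) × Fin 4

/-- The tensor wavelets `Ψ_I`. -/
def tensorWavelet (φ ψ : ℝ → ℝ) (I : WaveletIndex) (z : ℝ × ℝ) : ℝ :=
  match I with
  | (j, (kx, ky), 0) => dilate φ j kx z.1 * dilate φ j ky z.2
  | (j, (kx, ky), 1) => dilate φ j kx z.1 * dilate ψ j ky z.2
  | (j, (kx, ky), 2) => dilate ψ j kx z.1 * dilate φ j ky z.2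
  | (j, (kx, ky), 3) => dilate ψ j kx z.1 * dilate ψ j ky z.2

/-- The dual function
`γ_I(x, θ) = (1/4π) ∫ |u| Ψ̂_I(u cos θ, u sin θ) exp(ixu) du`. As `Ψ_I` is real the integral is a
real number. -/
def dualFun (φ ψ : ℝ → ℝ) (I : WaveletIndex) (x θ : ℝ) : ℝ :=
  (1 / (4 * Real.pi)) *
    (∫ u : ℝ, ((|u| : ℝ) : ℂ) *
      fourier2 (fun z => (tensorWavelet φ ψ I z : ℂ)) (u * Real.cos θ, u * Real.sin θ) *
        Complex.exp (Complex.I * ((x * u : ℝ) : ℂ))).re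

/-- `B_e = ‖γ_{0,0,e}‖_∞`, the supremum over `ℝ × [0, π]`. -/
def dualSup (φ ψ : ℝ → ℝ) (e : Fin 4) : ℝ :=
  sSup ((fun z : ℝ × ℝ => |dualFun φ ψ (0, (0, 0), e) z.1 z.2|) ''
    (Set.univ ×ˢ Set.Icc 0 Real.pi))

/-- The point `2^{-j} k` at which `Ψ_I` is located. -/
def position (I : WaveletIndex) : ℝ × ℝ :=
  ((2 : ℝ) ^ (-I.1) * I.2.1.1, (2 : ℝ) ^ (-I.1) * I.2.1.2)

/-! ### Models, estimators, penalties -/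

/-- The indices of the vectors common to all models: father wavelets of scale `j₁` located
in `D`. -/
def coarseIndices (D : Set (ℝ × ℝ)) (j₁ : ℤ) : Set WaveletIndex :=
  {I | I.1 = j₁ ∧ I.2.2 = 0 ∧ position I ∈ D}

/-- The detail indices: types `1, 2, 3`, scales `j₁ ≤ j < j₀`, located in `D`. -/
def detailIndices (D : Set (ℝ × ℝ)) (j₁ j₀ : ℤ) : Set WaveletIndex :=
  {I | j₁ ≤ I.1 ∧ I.1 < j₀ ∧ I.2.2 ≠ 0 ∧ position I ∈ D}

/-- All indices that may occur in a model. -/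
def allIndices (D : Set (ℝ × ℝ)) (j₁ j₀ : ℤ) : Set WaveletIndex :=
  coarseIndices D j₁ ∪ detailIndices D j₁ j₀

/-- `x_I = 2 (j + ln B_e) + y_I`. -/
def xWeight (φ ψ : ℝ → ℝ) (y : WaveletIndex → ℝ) (I : WaveletIndex) : ℝ :=
  2 * ((I.1 : ℝ) + Real.log (dualSup φ ψ I.2.2)) + y I

/-- The set of models: all coarse indices, plus an arbitrary set of detail indices, with
`x_I ≤ n` for all indices of the model. -/
def models (φ ψ : ℝ → ℝ) (y : WaveletIndex → ℝ) (n : ℕ) (D : Set (ℝ × ℝ)) (j₁ j₀ : ℤ) :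
    Set (Finset WaveletIndex) :=
  {m | coarseIndices D j₁ ⊆ (m : Set WaveletIndex) ∧
    (m : Set WaveletIndex) ⊆ allIndices D j₁ j₀ ∧ ∀ I ∈ m, xWeight φ ψ y I ≤ n}

/-- The function `∑_{I ∈ m} c_I Ψ_I`. -/
def combination (φ ψ : ℝ → ℝ) (m : Finset WaveletIndex) (c : WaveletIndex → ℝ) (z : ℝ × ℝ) : ℝ :=
  ∑ I ∈ m, c I * tensorWavelet φ ψ I z

/-- The squared `L²(ℝ²)` distance. -/
def distSq (f g : ℝ × ℝ → ℝ) : ℝ := ∫ z : ℝ × ℝ, (f z - g z) ^ 2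

/-- `d²(f, m)`, the squared `L²` distance from `f` to the span of the `Ψ_I`, `I ∈ m`. -/
def biasSq (φ ψ : ℝ → ℝ) (f : ℝ × ℝ → ℝ) (m : Finset WaveletIndex) : ℝ :=
  ⨅ c : WaveletIndex → ℝ, distSq f (combination φ ψ m c)

/-- The empirical mean `(1/n) ∑_{i} f(X_i, Φ_i)` over a sample of size `n`. -/
def empMean {n : ℕ} (s : Fin n → ℝ × ℝ) (f : ℝ → ℝ → ℝ) : ℝ :=
  (1 / (n : ℝ)) * ∑ i, f (s i).1 (s i).2

/-- The empirical coefficient `(1/n) ∑_{i} γ_I(X_i, Φ_i)`. -/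
def empCoeff (φ ψ : ℝ → ℝ) {n : ℕ} (s : Fin n → ℝ × ℝ) (I : WaveletIndex) : ℝ :=
  empMean s (dualFun φ ψ I)

/-- The projection estimator on the model `m`. -/
def projEstimator (φ ψ : ℝ → ℝ) {n : ℕ} (s : Fin n → ℝ × ℝ) (m : Finset WaveletIndex) :
    ℝ × ℝ → ℝ :=
  combination φ ψ m (empCoeff φ ψ s)

/-- The empirical contrast `‖τ‖² - 2 ∑_{I ∈ m} τ_I (1/n) ∑_{i} γ_I(X_i, Φ_i)` of
`τ = ∑_{I ∈ m} τ_I Ψ_I`. -/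
def empContrast (φ ψ : ℝ → ℝ) {n : ℕ} (s : Fin n → ℝ × ℝ) (m : Finset WaveletIndex)
    (τ : WaveletIndex → ℝ) : ℝ :=
  distSq (combination φ ψ m τ) 0 - 2 * ∑ I ∈ m, τ I * empCoeff φ ψ s I

/-- The random penalty of a model. -/
def penalty (φ ψ : ℝ → ℝ) (ε α : ℝ) (y : WaveletIndex → ℝ) {n : ℕ} (s : Fin n → ℝ × ℝ)
    (m : Finset WaveletIndex) : ℝ :=
  (1 + ε) / n * ∑ I ∈ m,
    2 * (Real.sqrt (2 / (1 - α) * xWeight φ ψ y I *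
            (empMean s (fun x θ => dualFun φ ψ I x θ ^ 2) +
              1 / n * (2 : ℝ) ^ (2 * I.1) * dualSup φ ψ I.2.2 ^ 2 * (1 / 3 + 1 / α) *
                xWeight φ ψ y I)) +
          (2 : ℝ) ^ I.1 * dualSup φ ψ I.2.2 / (3 * Real.sqrt n) * xWeight φ ψ y I) ^ 2

/-- `m` minimizes the penalized empirical contrast of the projection estimator over the set of
models `M`. -/
def IsSelected (φ ψ : ℝ → ℝ) (ε α : ℝ) (y : WaveletIndex → ℝ) {n : ℕ} (s : Fin n → ℝ × ℝ)
    (M : Set (Finset WaveletIndex)) (m : Finset WaveletIndex) : Prop :=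
  m ∈ M ∧ ∀ m' ∈ M,
    empContrast φ ψ s m (empCoeff φ ψ s) + penalty φ ψ ε α y s m ≤
      empContrast φ ψ s m' (empCoeff φ ψ s) + penalty φ ψ ε α y s m'

end QHT

end

open QHT

/-!
The proof compares the selected estimator with every model coefficient by coefficient.

Orthonormality. On the indices that occur in the models the `Ψ_I` form an orthonormal family
(`integral_tensorWavelet_mul`), because the father wavelets of a scale are orthogonal to the mother
wavelets of the same and all finer scales. Hence distances, biases and contrasts are sums over
indices, and the defining inequality of the selected model yields an oracle inequality
(`oracle_inequality`, `ofReal_loss_sub_le`) whose remainder is `1 + ε` times the sum over `I` of the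
positive parts of `(α_I - β_I)² - P_I`, where `β_I = ∫ W_E Ψ_I` and `(1 + ε) P_I` is the share of
`I` in the penalty.

Unbiasedness. The mean of `γ_I` under the law of the data is `∫ W Ψ_I`
(`integral_dualFun_dataLaw`). By Fubini's theorem the integral over `x` of the quadrature density
against `exp (ixu)` produces the quantum characteristic function on the line of direction `θ`; the
factor `|u|` is the Jacobian of polar coordinates, with radii of both signs and `θ ∈ [0, π)`
(`setIntegral_half_polar`); and Fourier inversion turns the resulting integral over the plane into
`∫ W Ψ_I` through the duality that specifies `W`. Three integrable derivatives give a cubic decay of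
the one-dimensional Fourier transforms, which makes the radial integrals converge uniformly in the
direction and gives `|γ_I| ≤ 2 ^ j B_e`, by scaling.

Concentration. Bernstein's inequality (`measure_sqrt_add_lt_sum_le`) for `γ_I`, `-γ_I` and `-γ_I²`
bounds `√n |α_I - β_I|` by the data-driven quantity `devBound` at level `x`, outside an event of
probability `3 exp (-x)`. This bound is subadditive in the level, so that the excess of the squared
deviation over the penalty, on the event that level `x + k` is the first one of these at which the
bound holds, is at most `2 / n` times the squared bound at level `k`. Summation over `k` gives an
expected excess of order `2 ^ (2 j) B_e² exp (-x_I) / n ≤ exp (-y_I) / n`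
(`lintegral_sq_sub_devBound_le`, `sq_bound_mul_exp_neg_xWeight_le`), and summation over `I` gives `C
σ / n`; the second term of the bound is then only added.
-/

/-! ### Bernstein's inequality -/

theorem exp_le_one_add_add_sq_div {y c : ℝ} (hy : |y| ≤ c) (hc : c < 3) :
    Real.exp y ≤ 1 + y + y ^ 2 / (2 * (1 - c / 3)) := by
  have hc0 : 0 ≤ c := (abs_nonneg y).trans hy
  have h1 : HasSum (fun k : ℕ => y ^ k / (k.factorial : ℝ)) (Real.exp y) := by
    rw [Real.exp_eq_exp_ℝ]; exact NormedSpace.expSeries_div_hasSum_exp y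
  have h2 : HasSum (fun k : ℕ => y ^ (k + 2) / ((k + 2).factorial : ℝ)) (Real.exp y - (1 + y)) := by
    have := (hasSum_nat_add_iff' 2).2 h1
    simpa [Finset.sum_range_succ] using this
  have h3 : HasSum (fun k : ℕ => y ^ 2 / 2 * (c / 3) ^ k) (y ^ 2 / 2 * (1 - c / 3)⁻¹) :=
    (hasSum_geometric_of_lt_one (by positivity) (by linarith)).mul_left _
  have h4 := hasSum_le (fun k => ?_) h2 h3
  · have h5 : y ^ 2 / 2 * (1 - c / 3)⁻¹ = y ^ 2 / (2 * (1 - c / 3)) := by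
      rw [← div_eq_mul_inv, div_div]
    linarith
  · have hf : (2 : ℝ) * 3 ^ k ≤ ((k + 2).factorial : ℝ) := by
      have := Nat.factorial_mul_pow_le_factorial (m := 2) (n := k)
      rw [add_comm 2 k] at this
      exact_mod_cast this
    calc y ^ (k + 2) / ((k + 2).factorial : ℝ)
        ≤ |y| ^ (k + 2) / ((k + 2).factorial : ℝ) := by
          refine div_le_div_of_nonneg_right ?_ (by positivity)
          rw [← abs_pow]; exact le_abs_self _
      _ ≤ (c ^ k * y ^ 2) / (2 * 3 ^ k) := by
          rw [pow_add, sq_abs]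
          gcongr
      _ = y ^ 2 / 2 * (c / 3) ^ k := by
          rw [div_pow]; field_simp

section Bernstein

variable {Ω ι : Type*} [MeasurableSpace Ω] {P : Measure Ω} [IsProbabilityMeasure P] [Fintype ι]

/-- The moment generating function is controlled through the second moment about the origin and the
bound on `|X|` itself rather than on `|X - E X|`; this gives the constant `b / 3`. -/
theorem mgf_le_of_abs_le {X : Ω → ℝ} {b μ v l : ℝ} (hX : Measurable X)
    (hb : ∀ᵐ ω ∂P, |X ω| ≤ b) (hμ : ∫ ω, X ω ∂P = μ) (hv : ∫ ω, X ω ^ 2 ∂P ≤ v)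
    (hl : 0 ≤ l) (hlb : l * b < 3) :
    mgf X P l ≤ Real.exp (l * μ + l ^ 2 * v / (2 * (1 - l * b / 3))) := by
  have hpos : 0 < 2 * (1 - l * b / 3) := by linarith
  have hi : Integrable X P := Integrable.of_bound hX.aestronglyMeasurable b (by simpa using hb)
  have hi2 : Integrable (fun ω => X ω ^ 2) P := by
    refine Integrable.of_bound (hX.pow_const 2).aestronglyMeasurable (b ^ 2) ?_
    filter_upwards [hb] with ω h
    rw [Real.norm_eq_abs, abs_pow]; gcongr
  have hle : ∀ᵐ ω ∂P, Real.exp (l * X ω) ≤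
      1 + l * X ω + l ^ 2 / (2 * (1 - l * b / 3)) * X ω ^ 2 := by
    filter_upwards [hb] with ω h
    have := exp_le_one_add_add_sq_div (y := l * X ω) (c := l * b)
      (by rw [abs_mul, abs_of_nonneg hl]; gcongr) hlb
    calc _ ≤ _ := this
      _ = _ := by ring
  have hint : Integrable (fun ω => 1 + l * X ω + l ^ 2 / (2 * (1 - l * b / 3)) * X ω ^ 2) P :=
    ((integrable_const _).add (hi.const_mul _)).add (hi2.const_mul _)
  calc mgf X P l ≤ ∫ ω, (1 + l * X ω + l ^ 2 / (2 * (1 - l * b / 3)) * X ω ^ 2) ∂P := by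
        refine integral_mono_of_nonneg (ae_of_all _ fun ω => (Real.exp_pos _).le) hint hle
    _ = 1 + l * μ + l ^ 2 / (2 * (1 - l * b / 3)) * ∫ ω, X ω ^ 2 ∂P := by
        have hi1 : Integrable (fun ω => 1 + l * X ω) P := (integrable_const _).add (hi.const_mul _)
        rw [integral_add hi1 (hi2.const_mul _),
          integral_add (integrable_const _) (hi.const_mul _), integral_const_mul,
          integral_const_mul, hμ]
        simp
    _ ≤ 1 + (l * μ + l ^ 2 * v / (2 * (1 - l * b / 3))) := by
        have : l ^ 2 / (2 * (1 - l * b / 3)) * ∫ ω, X ω ^ 2 ∂P ≤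
          l ^ 2 / (2 * (1 - l * b / 3)) * v := by gcongr
        have h2 : l ^ 2 / (2 * (1 - l * b / 3)) * v = l ^ 2 * v / (2 * (1 - l * b / 3)) := by ring
        linarith
    _ ≤ _ := by linarith [Real.add_one_le_exp (l * μ + l ^ 2 * v / (2 * (1 - l * b / 3)))]

/-- Bernstein's inequality with the second moment about the origin. -/
theorem measure_sqrt_add_lt_sum_le {X : ι → Ω → ℝ} {b μ v x : ℝ} (hX : ∀ i, Measurable (X i))
    (hind : iIndepFun X P) (hb : ∀ i, ∀ᵐ ω ∂P, |X i ω| ≤ b) (hb0 : 0 ≤ b)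
    (hμ : ∀ i, ∫ ω, X i ω ∂P = μ)
    (hv : ∀ i, ∫ ω, X i ω ^ 2 ∂P ≤ v) (hx : 0 ≤ x) :
    P {ω | Real.sqrt (2 * (Fintype.card ι * v) * x) + b / 3 * x <
      ∑ i, X i ω - Fintype.card ι * μ} ≤ ENNReal.ofReal (Real.exp (-x)) := by
  set N : ℝ := (Fintype.card ι : ℝ) with hN
  have hN0 : 0 ≤ N := by positivity
  rcases le_or_gt (N * v) 0 with h0 | hV
  · -- no variance: all variables vanish almost surely
    have hz : ∀ i, X i =ᵐ[P] 0 := by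
      intro i
      have hNp : 0 < N := by
        have : Nonempty ι := ⟨i⟩
        rw [hN]; exact_mod_cast Fintype.card_pos
      have hv0 : v ≤ 0 := by
        by_contra! h
        exact absurd h0 (not_le.2 (mul_pos hNp h))
      have hi2 : Integrable (fun ω => X i ω ^ 2) P := by
        refine Integrable.of_bound ((hX i).pow_const 2).aestronglyMeasurable (b ^ 2) ?_
        filter_upwards [hb i] with ω h
        rw [Real.norm_eq_abs, abs_pow]; gcongr
      have h1 : ∫ ω, X i ω ^ 2 ∂P = 0 :=
        le_antisymm ((hv i).trans hv0) (integral_nonneg fun ω => sq_nonneg _)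
      have h2 := (integral_eq_zero_iff_of_nonneg (fun ω => sq_nonneg _) hi2).1 h1
      filter_upwards [h2] with ω h
      simpa using h
    have hNμ : N * μ = 0 := by
      rcases isEmpty_or_nonempty ι with he | ⟨⟨i⟩⟩
      · simp [hN]
      · have : μ = 0 := by
          rw [← hμ i, integral_congr_ae (hz i)]; simp
        simp [this]
    have hall : ∀ᵐ ω ∂P, ∀ i, X i ω = 0 := ae_all_iff.2 fun i => hz i
    have : P {ω | Real.sqrt (2 * (N * v) * x) + b / 3 * x < ∑ i, X i ω - N * μ} = 0 := by
      refine measure_mono_null ?_ (ae_iff.1 hall)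
      intro ω hω hcon
      simp only [Set.mem_ofPred_eq] at hω hcon
      rw [hNμ, Finset.sum_eq_zero fun i _ => hcon i] at hω
      have : 0 ≤ Real.sqrt (2 * (N * v) * x) + b / 3 * x := by positivity
      linarith
    rw [this]; exact zero_le
  · set V := N * v with hVdef
    -- `l = s / (1 + c s)` below is the optimal exponent in the Chernoff bound
    set s := Real.sqrt (2 * x / V) with hs
    have hs0 : 0 ≤ s := Real.sqrt_nonneg _
    have hs2 : s ^ 2 * V = 2 * x := by
      rw [hs, Real.sq_sqrt (by positivity)]; field_simp
    set c := b / 3 with hc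
    have hc0 : 0 ≤ c := by positivity
    have hd : 0 < 1 + c * s := by positivity
    set l := s / (1 + c * s) with hl
    have hl0 : 0 ≤ l := by positivity
    have hlc : 1 - l * b / 3 = 1 / (1 + c * s) := by
      rw [hl, hc]; rw [hc] at hd; field_simp; ring
    have hlb : l * b < 3 := by
      have : 0 < 1 - l * b / 3 := by rw [hlc]; positivity
      linarith
    have hsq : Real.sqrt (2 * V * x) = V * s := by
      rw [Real.sqrt_eq_iff_mul_self_eq (by positivity) (by positivity)]
      linear_combination -V * hs2
    set t := Real.sqrt (2 * V * x) + c * x with ht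
    have hmgf :
        mgf (∑ i, X i) P l ≤ Real.exp (l * (N * μ) + l ^ 2 * V / (2 * (1 - l * b / 3))) := by
      rw [hind.mgf_sum hX]
      calc ∏ i, mgf (X i) P l ≤ ∏ _i : ι, Real.exp (l * μ + l ^ 2 * v / (2 * (1 - l * b / 3))) :=
            Finset.prod_le_prod (fun i _ => mgf_nonneg)
              fun i _ => mgf_le_of_abs_le (hX i) (hb i) (hμ i) (hv i) hl0 hlb
        _ = _ := by
            rw [Finset.prod_const, ← Real.exp_nat_mul, Finset.card_univ, ← hN, hVdef]
            congr 1; ring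
    have hint : Integrable (fun ω => Real.exp (l * (∑ i, X i) ω)) P := by
      refine integrable_exp_mul_of_le l (N * b) hl0
        (by simpa [← Finset.sum_fn] using
          (Finset.measurable_sum _ fun i _ => hX i :
            Measurable fun ω => ∑ i, X i ω).aemeasurable) ?_
      filter_upwards [ae_all_iff.2 hb] with ω h
      rw [Finset.sum_apply]
      calc ∑ i, X i ω ≤ ∑ _i : ι, b := Finset.sum_le_sum fun i _ => (le_abs_self _).trans (h i)
        _ = N * b := by simp [hN]
    have hch := measure_ge_le_exp_mul_mgf (μ := P) (X := ∑ i, X i) (t + N * μ) hl0 hint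
    have hfin : P.real {ω | t + N * μ ≤ (∑ i, X i) ω} ≤ Real.exp (-x) := by
      refine hch.trans ((mul_le_mul_of_nonneg_left hmgf (Real.exp_pos _).le).trans ?_)
      rw [← Real.exp_add]
      refine Real.exp_le_exp.2 (le_of_eq ?_)
      have e1 : l * t = (2 * x + c * s * x) / (1 + c * s) := by
        rw [ht, hsq, hl, div_mul_eq_mul_div]
        congr 1
        linear_combination hs2
      have e2 : l ^ 2 * V / (2 * (1 - l * b / 3)) = x / (1 + c * s) := by
        rw [hlc, hl, div_pow, div_mul_eq_mul_div, hs2]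
        field_simp
      rw [e2]
      calc -l * (t + N * μ) + (l * (N * μ) + x / (1 + c * s)) = -(l * t) + x / (1 + c * s) := by
              ring
        _ = -x := by rw [e1]; field_simp; ring
    refine (measure_mono fun ω hω => ?_).trans
      ((ENNReal.le_ofReal_iff_toReal_le (measure_ne_top P _) (Real.exp_pos _).le).2 hfin)
    simp only [Set.mem_ofPred_eq, Finset.sum_apply] at hω ⊢
    linarith

/-! ### Deviations of an empirical mean, with the variance estimated from the data -/

/-- The data-driven deviation bound at level `x` for `√n` times the centred empirical mean of `n`
variables bounded by `b`, where `q` is the empirical second moment. -/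
noncomputable def devBound (α b n q x : ℝ) : ℝ :=
  Real.sqrt (2 / (1 - α) * x * (q + 1 / n * b ^ 2 * (1 / 3 + 1 / α) * x)) +
    b / (3 * Real.sqrt n) * x

theorem devBound_zero (α b n q : ℝ) : devBound α b n q 0 = 0 := by
  simp [devBound]

/-- Subadditivity of the deviation bound in the level. -/
theorem devBound_add_le {α b n q x t : ℝ} (hα : 0 < α) (hα1 : α < 1) (hn : 0 ≤ n) (hq : 0 ≤ q)
    (hx : 0 ≤ x) (ht : 0 ≤ t) :
    devBound α b n q (x + t) ≤ devBound α b n q x + devBound α b n q t := by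
  unfold devBound
  set a := 2 / (1 - α) with ha
  have ha0 : 0 ≤ a := div_nonneg zero_le_two (by linarith)
  set c := 1 / n * b ^ 2 * (1 / 3 + 1 / α) with hc
  have hc0 : 0 ≤ c := by positivity
  have h : Real.sqrt (a * (x + t) * (q + c * (x + t))) ≤
      Real.sqrt (a * x * (q + c * x)) + Real.sqrt (a * t * (q + c * t)) := by
    rw [Real.sqrt_le_left (by positivity), add_sq, Real.sq_sqrt (by positivity),
      Real.sq_sqrt (by positivity)]
    have h1 :
        a * c * x * t ≤ Real.sqrt (a * x * (q + c * x)) * Real.sqrt (a * t * (q + c * t)) := by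
      rw [← Real.sqrt_mul (by positivity)]
      refine Real.le_sqrt_of_sq_le ?_
      have : 0 ≤ a ^ 2 * x * t * (q ^ 2 + q * c * (x + t)) := by positivity
      nlinarith
    nlinarith
  linarith

theorem devBound_sq_le {α b n q k : ℝ} (hα : 0 < α) (hα1 : α < 1) (hn : 1 ≤ n) (hq : 0 ≤ q)
    (hqb : q ≤ b ^ 2) (hk : 1 ≤ k) :
    devBound α b n q k ^ 2 ≤ (4 / (1 - α) * (4 / 3 + 1 / α) + 1) * b ^ 2 * k ^ 2 := by
  unfold devBound
  have ha0 : 0 < 1 - α := by linarith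
  have hn0 : 0 < n := by linarith
  refine (add_sq_le).trans ?_
  rw [Real.sq_sqrt (by positivity), mul_pow, div_pow, mul_pow, Real.sq_sqrt hn0.le]
  have h1 : q + 1 / n * b ^ 2 * (1 / 3 + 1 / α) * k ≤ b ^ 2 * (4 / 3 + 1 / α) * k := by
    have e1 : q ≤ b ^ 2 * k := hqb.trans (le_mul_of_one_le_right (sq_nonneg b) hk)
    have e2 : 1 / n * b ^ 2 * (1 / 3 + 1 / α) * k ≤ 1 * b ^ 2 * (1 / 3 + 1 / α) * k := by
      gcongr
      rw [div_le_one hn0]; exact hn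
    linarith
  have h2 : b ^ 2 / (3 ^ 2 * n) ≤ b ^ 2 / 2 := by
    gcongr; linarith
  calc 2 * (2 / (1 - α) * k * (q + 1 / n * b ^ 2 * (1 / 3 + 1 / α) * k) +
        b ^ 2 / (3 ^ 2 * n) * k ^ 2)
      ≤ 2 * (2 / (1 - α) * k * (b ^ 2 * (4 / 3 + 1 / α) * k) + b ^ 2 / 2 * k ^ 2) := by gcongr
    _ = _ := by ring

/-- The theoretical Bernstein bound is below the data-driven one once the second moment `v` is
controlled by the empirical second moment `q`. -/
theorem bernstein_le_devBound {α b n q v x : ℝ} (hα : 0 < α) (hα1 : α < 1) (hn : 0 < n)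
    (hv : 0 ≤ v) (hx : 0 ≤ x)
    (h : n * v - n * q ≤ Real.sqrt (2 * (n * (b ^ 2 * v)) * x) + b ^ 2 / 3 * x) :
    Real.sqrt (2 * (n * v) * x) + b / 3 * x ≤ Real.sqrt n * devBound α b n q x := by
  have hα1' : 0 < 1 - α := by linarith
  -- the arithmetic-geometric mean inequality absorbs the unknown `v`
  have h1 : Real.sqrt (2 * (n * (b ^ 2 * v)) * x) ≤ α * (n * v) + b ^ 2 * x / α := by
    rw [Real.sqrt_le_left (by positivity)]
    have e : (α * (n * v) + b ^ 2 * x / α) ^ 2 =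
        (α * (n * v)) ^ 2 + 2 * (n * (b ^ 2 * v)) * x + (b ^ 2 * x / α) ^ 2 := by
      field_simp; ring
    rw [e]
    nlinarith [sq_nonneg (α * (n * v)), sq_nonneg (b ^ 2 * x / α)]
  have h2 : n * v ≤ (1 / (1 - α)) * (n * (q + 1 / n * b ^ 2 * (1 / 3 + 1 / α) * x)) := by
    rw [div_mul_eq_mul_div, one_mul, le_div_iff₀ hα1']
    have e : n * (q + 1 / n * b ^ 2 * (1 / 3 + 1 / α) * x) =
        n * q + (b ^ 2 / 3 * x + b ^ 2 * x / α) := by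
      field_simp
    rw [e]; linarith
  unfold devBound
  rw [mul_add, ← Real.sqrt_mul hn.le]
  have h3 : Real.sqrt n * (b / (3 * Real.sqrt n) * x) = b / 3 * x := by
    have : Real.sqrt n ≠ 0 := (Real.sqrt_pos.2 hn).ne'
    field_simp
  rw [h3]
  refine add_le_add (Real.sqrt_le_sqrt ?_) le_rfl
  calc 2 * (n * v) * x
      ≤ 2 * ((1 / (1 - α)) * (n * (q + 1 / n * b ^ 2 * (1 / 3 + 1 / α) * x))) * x := by
        gcongr
    _ = _ := by ring

/-- The constant of the integrated deviation inequality. -/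
noncomputable def devConst (α : ℝ) : ℝ :=
  6 * (4 / (1 - α) * (4 / 3 + 1 / α) + 1) * ∑' k : ℕ, ((k : ℝ) + 1) ^ 2 * Real.exp (-(k : ℝ))

theorem summable_sq_mul_exp_neg :
    Summable fun k : ℕ => ((k : ℝ) + 1) ^ 2 * Real.exp (-(k : ℝ)) := by
  have h := (summable_nat_add_iff 1).2 (Real.summable_pow_mul_exp_neg_nat_mul 2 one_pos)
  refine (h.mul_left (Real.exp 1)).congr fun k => ?_
  push_cast
  rw [mul_left_comm, ← Real.exp_add]
  ring_nf

theorem devConst_nonneg {α : ℝ} (hα : 0 < α) (hα1 : α < 1) : 0 ≤ devConst α := by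
  have : 0 < 1 - α := by linarith
  unfold devConst
  have : 0 ≤ ∑' k : ℕ, ((k : ℝ) + 1) ^ 2 * Real.exp (-(k : ℝ)) := tsum_nonneg fun k => by positivity
  positivity

/-- The centred empirical mean exceeds the data-driven bound at level `x` with probability at most
`3 exp (-x)`: two applications of Bernstein's inequality to `±Z`, and one to `-Z²`, whose second
moment is at most `b² E Z²`. -/
theorem measure_devBound_lt_le {Z : ι → Ω → ℝ} {α b μ v x : ℝ} (hα : 0 < α) (hα1 : α < 1)
    [Nonempty ι] (hZ : ∀ i, Measurable (Z i)) (hind : iIndepFun Z P)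
    (hb : ∀ i, ∀ᵐ ω ∂P, |Z i ω| ≤ b) (hb0 : 0 ≤ b) (hμ : ∀ i, ∫ ω, Z i ω ∂P = μ)
    (hv : ∀ i, ∫ ω, Z i ω ^ 2 ∂P = v) (hx : 0 ≤ x) :
    P {ω | devBound α b (Fintype.card ι) ((1 / (Fintype.card ι : ℝ)) * ∑ i, Z i ω ^ 2) x <
      Real.sqrt (Fintype.card ι) * |(1 / (Fintype.card ι : ℝ)) * ∑ i, Z i ω - μ|} ≤
      ENNReal.ofReal (3 * Real.exp (-x)) := by
  set n : ℝ := (Fintype.card ι : ℝ) with hn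
  have hn0 : 0 < n := by rw [hn]; exact_mod_cast Fintype.card_pos
  have hv0 : 0 ≤ v := by
    obtain ⟨i⟩ := ‹Nonempty ι›
    rw [← hv i]; exact integral_nonneg fun ω => sq_nonneg _
  have b1 := measure_sqrt_add_lt_sum_le hZ hind hb hb0 hμ (fun i => (hv i).le) hx
  have b2 := measure_sqrt_add_lt_sum_le (X := fun i ω => -Z i ω) (P := P) (fun i => (hZ i).neg)
    (hind.comp (fun _ z => -z) fun _ => measurable_neg) (by simpa using hb) hb0 (μ := -μ) (v := v)
    (fun i => by rw [integral_neg, hμ]) (fun i => by simpa using (hv i).le) hx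
  have b3 := measure_sqrt_add_lt_sum_le (X := fun i ω => -Z i ω ^ 2) (P := P) (b := b ^ 2)
    (μ := -v) (v := b ^ 2 * v)
    (fun i => ((hZ i).pow_const 2).neg)
    (hind.comp (fun _ z => -z ^ 2) fun _ => (measurable_id.pow_const 2).neg)
    (fun i => by
      filter_upwards [hb i] with ω h
      rw [abs_neg, abs_pow]; gcongr) (sq_nonneg b)
    (fun i => by rw [integral_neg, hv])
    (fun i => by
      rw [← hv i, ← integral_const_mul]
      refine integral_mono_of_nonneg (ae_of_all _ fun ω => sq_nonneg _) ?_ ?_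
      · refine Integrable.const_mul ?_ _
        refine Integrable.of_bound ((hZ i).pow_const 2).aestronglyMeasurable (b ^ 2) ?_
        filter_upwards [hb i] with ω h
        rw [Real.norm_eq_abs, abs_pow]; gcongr
      · filter_upwards [hb i] with ω h
        have : Z i ω ^ 2 ≤ b ^ 2 := by rw [← sq_abs]; gcongr
        calc (-Z i ω ^ 2) ^ 2 = Z i ω ^ 2 * Z i ω ^ 2 := by ring
          _ ≤ b ^ 2 * Z i ω ^ 2 := by gcongr) hx
  rw [← hn] at b1 b2 b3
  have hsub : {ω | devBound α b n ((1 / n) * ∑ i, Z i ω ^ 2) x <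
      Real.sqrt n * |(1 / n) * ∑ i, Z i ω - μ|} ⊆
      ({ω | Real.sqrt (2 * (n * v) * x) + b / 3 * x < ∑ i, Z i ω - n * μ} ∪
        {ω | Real.sqrt (2 * (n * v) * x) + b / 3 * x < ∑ i, -Z i ω - n * (-μ)}) ∪
      {ω | Real.sqrt (2 * (n * (b ^ 2 * v)) * x) + b ^ 2 / 3 * x < ∑ i, -Z i ω ^ 2 - n * (-v)} := by
    intro ω hω
    by_contra hcon
    simp only [Set.mem_union, Set.mem_ofPred_eq, not_or, not_lt, Finset.sum_neg_distrib] at hcon hω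
    obtain ⟨⟨c1, c2⟩, c3⟩ := hcon
    have hq : n * ((1 / n) * ∑ i, Z i ω ^ 2) = ∑ i, Z i ω ^ 2 := by field_simp
    have hd := bernstein_le_devBound (α := α) (b := b) (q := (1 / n) * ∑ i, Z i ω ^ 2)
      hα hα1 hn0 hv0 hx (by rw [hq]; linarith)
    have ha : n * |(1 / n) * ∑ i, Z i ω - μ| ≤ Real.sqrt (2 * (n * v) * x) + b / 3 * x := by
      rw [← abs_of_pos hn0, ← abs_mul, abs_of_pos hn0, mul_sub, ← mul_assoc,
        mul_one_div_cancel hn0.ne',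
        one_mul, abs_le]
      constructor <;> linarith
    have h4 : Real.sqrt n * (Real.sqrt n * |(1 / n) * ∑ i, Z i ω - μ|) ≤
        Real.sqrt n * devBound α b n ((1 / n) * ∑ i, Z i ω ^ 2) x := by
      rw [← mul_assoc, Real.mul_self_sqrt hn0.le]
      exact ha.trans hd
    exact absurd (le_of_mul_le_mul_left h4 (Real.sqrt_pos.2 hn0)) (not_le.2 hω)
  refine (measure_mono hsub).trans ((measure_union_le _ _).trans
    ((add_le_add ((measure_union_le _ _).trans (add_le_add b1 b2)) b3).trans (le_of_eq ?_)))
  rw [← ENNReal.ofReal_add (Real.exp_pos _).le (Real.exp_pos _).le,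
    ← ENNReal.ofReal_add (by positivity) (Real.exp_pos _).le]
  congr 1; ring

/-- The integrated form of the deviation inequality. The factor `2` in front of the squared bound
at level `x` leaves room for the excess at the levels `x + k`. -/
theorem lintegral_sq_sub_devBound_le {Z : ι → Ω → ℝ} {α b μ v x : ℝ} (hα : 0 < α) (hα1 : α < 1)
    [Nonempty ι] (hZ : ∀ i, Measurable (Z i)) (hind : iIndepFun Z P)
    (hb : ∀ i, ∀ᵐ ω ∂P, |Z i ω| ≤ b) (hb0 : 0 ≤ b) (hμ : ∀ i, ∫ ω, Z i ω ∂P = μ)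
    (hv : ∀ i, ∫ ω, Z i ω ^ 2 ∂P = v) :
    ∫⁻ ω, ENNReal.ofReal (((1 / (Fintype.card ι : ℝ)) * ∑ i, Z i ω - μ) ^ 2 -
      1 / (Fintype.card ι : ℝ) *
        (2 * devBound α b (Fintype.card ι)
          ((1 / (Fintype.card ι : ℝ)) * ∑ i, Z i ω ^ 2) x ^ 2)) ∂P ≤
      ENNReal.ofReal (devConst α * (b ^ 2 / (Fintype.card ι : ℝ)) * Real.exp (-x)) := by
  -- a negative level is worse than level `0` on both sides
  wlog hx : 0 ≤ x generalizing x
  · refine le_trans ?_ ((this le_rfl).trans ?_)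
    · refine lintegral_mono fun ω => ENNReal.ofReal_le_ofReal ?_
      rw [devBound_zero]
      refine sub_le_sub_left ?_ _
      rw [zero_pow two_ne_zero, mul_zero, mul_zero]
      positivity
    · have := devConst_nonneg hα hα1
      gcongr
      exact (not_le.1 hx).le
  set n : ℝ := (Fintype.card ι : ℝ) with hn
  have hn1 : 1 ≤ n := by rw [hn]; exact_mod_cast Fintype.card_pos
  have hn0 : 0 < n := by linarith
  set q : Ω → ℝ := fun ω => (1 / n) * ∑ i, Z i ω ^ 2 with hq
  set e : Ω → ℝ := fun ω => (1 / n) * ∑ i, Z i ω - μ with he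
  have hqm : Measurable q := (Finset.measurable_sum _ fun i _ => (hZ i).pow_const 2).const_mul _
  have hem : Measurable e := ((Finset.measurable_sum _ fun i _ => hZ i).const_mul _).sub_const _
  let Bad : ℕ → Set Ω := fun k => {ω | devBound α b n (q ω) (x + k) < Real.sqrt n * |e ω|}
  have hBm : ∀ k, MeasurableSet (Bad k) := fun k => by
    refine measurableSet_lt ?_ (hem.abs.const_mul _)
    unfold devBound
    fun_prop
  have hBP : ∀ k : ℕ, P (Bad k) ≤ ENNReal.ofReal (3 * Real.exp (-(x + k))) := fun k =>
    measure_devBound_lt_le hα hα1 hZ hind hb hb0 hμ hv (by positivity)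
  have hsum3 : Summable fun k : ℕ => 3 * Real.exp (-(x + k)) := by
    refine (Real.summable_exp_neg_nat.mul_left (3 * Real.exp (-x))).congr fun k => ?_
    rw [mul_assoc, ← Real.exp_add, neg_add]
  have hev : ∀ᵐ ω ∂P, ∀ᶠ k in Filter.atTop, ω ∉ Bad k := by
    refine ae_eventually_notMem (ne_top_of_le_ne_top ?_ (ENNReal.tsum_le_tsum hBP))
    rw [← ENNReal.ofReal_tsum_of_nonneg (fun k => by positivity) hsum3]
    exact ENNReal.ofReal_ne_top
  set D := 4 / (1 - α) * (4 / 3 + 1 / α) + 1 with hD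
  have hD0 : 0 ≤ D := by
    have : 0 < 1 - α := by linarith
    positivity
  have hpt : ∀ᵐ ω ∂P, ENNReal.ofReal (e ω ^ 2 - 1 / n * (2 * devBound α b n (q ω) x ^ 2)) ≤
      ∑' k : ℕ, (Bad k).indicator
        (fun _ => ENNReal.ofReal (2 * D * (b ^ 2 / n) * ((k : ℝ) + 1) ^ 2)) ω := by
    filter_upwards [hev, ae_all_iff.2 hb] with ω hω hbω
    have hq0 : 0 ≤ q ω := mul_nonneg (by positivity) (Finset.sum_nonneg fun i _ => sq_nonneg _)
    have hqb : q ω ≤ b ^ 2 := by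
      have : ∑ i, Z i ω ^ 2 ≤ n * b ^ 2 := by
        calc ∑ i, Z i ω ^ 2 ≤ ∑ _i : ι, b ^ 2 :=
              Finset.sum_le_sum fun i _ => by rw [← sq_abs]; gcongr; exact hbω i
          _ = n * b ^ 2 := by simp [hn]
      calc q ω ≤ (1 / n) * (n * b ^ 2) := by simp only [hq]; gcongr
        _ = b ^ 2 := by field_simp
    -- the first level at which the deviation bound holds
    have hex : ∃ k, ω ∉ Bad k := hω.exists
    classical
    have hk := Nat.find_spec hex
    have hmin := fun m => Nat.find_min hex (m := m)
    generalize Nat.find hex = k at hk hmin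
    simp only [Bad, Set.mem_ofPred_eq, not_lt] at hk
    have hA := hk.trans (devBound_add_le hα hα1 hn0.le hq0 hx (Nat.cast_nonneg k))
    have hsq : n * e ω ^ 2 ≤ 2 * devBound α b n (q ω) x ^ 2 + 2 * devBound α b n (q ω) k ^ 2 := by
      calc n * e ω ^ 2 = (Real.sqrt n * |e ω|) ^ 2 := by
            rw [mul_pow, Real.sq_sqrt hn0.le, sq_abs]
        _ ≤ (devBound α b n (q ω) x + devBound α b n (q ω) k) ^ 2 := by gcongr
        _ ≤ _ := by rw [← mul_add]; exact add_sq_le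
    have hle : e ω ^ 2 - 1 / n * (2 * devBound α b n (q ω) x ^ 2) ≤
        1 / n * (2 * devBound α b n (q ω) k ^ 2) := by
      rw [sub_le_iff_le_add, ← mul_add, div_mul_eq_mul_div, one_mul, le_div_iff₀ hn0]
      linarith
    rcases k with _ | k
    · rw [Nat.cast_zero, devBound_zero] at hle
      rw [ENNReal.ofReal_of_nonpos (by simpa using hle)]
      exact zero_le
    · have hmem : ω ∈ Bad k := not_not.1 (hmin k (Nat.lt_succ_self k))
      refine le_trans ?_ (ENNReal.le_tsum k)
      rw [Set.indicator_of_mem hmem]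
      refine ENNReal.ofReal_le_ofReal (hle.trans ?_)
      have := devBound_sq_le (n := n) (b := b) (q := q ω) (k := ((k + 1 : ℕ) : ℝ)) hα hα1 hn1 hq0
        hqb (by push_cast; linarith [Nat.cast_nonneg (α := ℝ) k])
      calc 1 / n * (2 * devBound α b n (q ω) ((k + 1 : ℕ) : ℝ) ^ 2)
          ≤ 1 / n * (2 * (D * b ^ 2 * ((k + 1 : ℕ) : ℝ) ^ 2)) := by gcongr
        _ = _ := by push_cast; ring
  calc _ ≤ ∫⁻ ω, ∑' k : ℕ, (Bad k).indicator
        (fun _ => ENNReal.ofReal (2 * D * (b ^ 2 / n) * ((k : ℝ) + 1) ^ 2)) ω ∂P :=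
        lintegral_mono_ae hpt
    _ = ∑' k : ℕ, ENNReal.ofReal (2 * D * (b ^ 2 / n) * ((k : ℝ) + 1) ^ 2) * P (Bad k) := by
        rw [lintegral_tsum fun k => (measurable_const.indicator (hBm k)).aemeasurable]
        simp_rw [lintegral_indicator_const (hBm _)]
    _ ≤ ∑' k : ℕ, ENNReal.ofReal (6 * D * (b ^ 2 / n) * Real.exp (-x) *
          (((k : ℝ) + 1) ^ 2 * Real.exp (-(k : ℝ)))) := by
        refine ENNReal.tsum_le_tsum fun k => ?_
        refine (mul_le_mul_right (hBP k) _).trans (le_of_eq ?_)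
        rw [← ENNReal.ofReal_mul (by positivity), neg_add, Real.exp_add]
        congr 1; ring
    _ = _ := by
        rw [← ENNReal.ofReal_tsum_of_nonneg (fun k => by positivity)
          (summable_sq_mul_exp_neg.mul_left _), tsum_mul_left]
        congr 1
        rw [devConst, ← hD]; ring

end Bernstein

/-! ### The deterministic part of penalized model selection -/

/-- The oracle inequality for coefficients with respect to an orthonormal family: `β` are the true
coefficients, `a` the estimated ones, `F` is the squared norm of the target, `m'` the selected
model and `P` the penalty per index. Every index contributes separately. -/
theorem oracle_inequality {ι : Type*} [DecidableEq ι] {ε F : ℝ} (hε : 0 < ε) (m m' : Finset ι)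
    (a β P : ι → ℝ) (hP : ∀ i, 0 ≤ P i) (hF : ∑ i ∈ m ∪ m', β i ^ 2 ≤ F)
    (hsel : -∑ i ∈ m', a i ^ 2 + (1 + ε) * ∑ i ∈ m', P i ≤
      -∑ i ∈ m, a i ^ 2 + (1 + ε) * ∑ i ∈ m, P i) :
    ε / (2 + ε) * (F - 2 * ∑ i ∈ m', a i * β i + ∑ i ∈ m', a i ^ 2) ≤
      (1 + 2 / ε) * (F - ∑ i ∈ m, β i ^ 2) + 2 * ((1 + ε) * ∑ i ∈ m, P i) +
        (1 + ε) * ∑ i ∈ m ∪ m', max ((a i - β i) ^ 2 - P i) 0 := by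
  have hm : ∀ f : ι → ℝ, ∑ i ∈ m, f i = ∑ i ∈ m ∪ m', if i ∈ m then f i else 0 := fun f => by
    rw [← Finset.sum_filter]; congr 1; ext i; simp +contextual
  have hm' : ∀ f : ι → ℝ, ∑ i ∈ m', f i = ∑ i ∈ m ∪ m', if i ∈ m' then f i else 0 := fun f => by
    rw [← Finset.sum_filter]; congr 1; ext i; simp +contextual
  have hk : ε / (2 + ε) ≤ 1 := by rw [div_le_one (by linarith)]; linarith
  have hk0 : 0 < ε / (2 + ε) := by positivity
  have hke : ε / (2 + ε) * (2 + ε) = ε := by field_simp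
  have hk2 : 0 < 2 / ε := by positivity
  have hk2e : 2 / ε * ε = 2 := by field_simp
  set k := ε / (2 + ε)
  set k2 := 2 / ε
  have hterm : ∀ i ∈ m ∪ m',
      k * (β i ^ 2 - 2 * (if i ∈ m' then a i * β i else 0) + if i ∈ m' then a i ^ 2 else 0) +
        ((1 + ε) * (if i ∈ m then P i else 0) - (1 + ε) * (if i ∈ m' then P i else 0) -
          (if i ∈ m then a i ^ 2 else 0) + if i ∈ m' then a i ^ 2 else 0) ≤
      (1 + k2) * (β i ^ 2 - if i ∈ m then β i ^ 2 else 0) +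
        2 * ((1 + ε) * if i ∈ m then P i else 0) + (1 + ε) * max ((a i - β i) ^ 2 - P i) 0 := by
    intro i hi
    obtain ⟨ν, hν⟩ : ∃ ν, a i = β i + ν := ⟨a i - β i, by ring⟩
    have hr : ν ^ 2 ≤ P i + max ((a i - β i) ^ 2 - P i) 0 := by
      have := le_max_left ((a i - β i) ^ 2 - P i) 0
      rw [hν, add_sub_cancel_left] at this ⊢
      linarith
    have hr0 := le_max_right ((a i - β i) ^ 2 - P i) 0
    have hPi := hP i
    generalize max ((a i - β i) ^ 2 - P i) 0 = r at hr hr0 ⊢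
    rw [hν]
    have hr' : (1 + ε) * ν ^ 2 ≤ (1 + ε) * (P i + r) := by gcongr
    rw [Finset.mem_union] at hi
    by_cases h1 : i ∈ m <;> by_cases h2 : i ∈ m'
    · simp only [h1, h2, if_true]
      have e1 : k * ν ^ 2 ≤ 1 * ν ^ 2 := by gcongr
      have e2 : 0 ≤ ε * (P i + r) := by positivity
      have e3 : 0 ≤ (1 + ε) * P i := by positivity
      linarith
    · simp only [h1, h2, if_true, if_false]
      -- the minimum of `(1 + ε) ν² + (β + ν)²` over `ν` is `(1 + ε) / (2 + ε) β²`
      have e1 : k * β i ^ 2 ≤ (1 + ε) * ν ^ 2 + (β i + ν) ^ 2 := by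
        have e2 : 0 ≤ ((2 + ε) * ν + β i) ^ 2 := sq_nonneg _
        have e3 : (2 + ε) * (k * β i ^ 2) ≤ (2 + ε) * ((1 + ε) * ν ^ 2 + (β i + ν) ^ 2) := by
          have : (2 + ε) * (k * β i ^ 2) = ε * β i ^ 2 := by rw [← mul_assoc, mul_comm _ k, hke]
          nlinarith [sq_nonneg (β i)]
        exact le_of_mul_le_mul_left e3 (by linarith)
      linarith
    · simp only [h1, h2, if_true, if_false]
      have e1 : k * ν ^ 2 + (β i + ν) ^ 2 ≤ (1 + k2) * β i ^ 2 + (1 + ε) * ν ^ 2 := by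
        have e2 : ε * (2 * β i * ν) ≤ ε * (k2 * β i ^ 2 + (ε - k) * ν ^ 2) := by
          have e3 : ε * (k2 * β i ^ 2) = 2 * β i ^ 2 := by rw [← mul_assoc, mul_comm ε, hk2e]
          have e4 : ε * 1 ≤ 2 * (ε - k) := by nlinarith
          have e5 : ε * ε * ν ^ 2 ≤ 2 * (ε * (ε - k) * ν ^ 2) := by
            have := mul_le_mul_of_nonneg_right e4 (by positivity : 0 ≤ ε * ν ^ 2)
            linarith
          nlinarith [sq_nonneg (2 * β i - ε * ν)]
        have := le_of_mul_le_mul_left e2 hε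
        linarith
      linarith
    · exact absurd hi (by simp [h1, h2])
  have hsum := Finset.sum_le_sum hterm
  simp only [Finset.sum_add_distrib, Finset.sum_sub_distrib, ← Finset.mul_sum, ← hm, ← hm'] at hsum
  have hR : k * (F - ∑ i ∈ m ∪ m', β i ^ 2) ≤ (1 + k2) * (F - ∑ i ∈ m ∪ m', β i ^ 2) := by
    have : 0 ≤ F - ∑ i ∈ m ∪ m', β i ^ 2 := by linarith
    gcongr; linarith
  linarith

/-! ### Orthonormality of the tensor wavelets -/

/-- The one-dimensional factor of `Ψ_I` in the first variable, for `I` of type `e`. -/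
def firstFactor (φ ψ : ℝ → ℝ) (e : Fin 4) : ℝ → ℝ := ![φ, φ, ψ, ψ] e

/-- The one-dimensional factor of `Ψ_I` in the second variable, for `I` of type `e`. -/
def secondFactor (φ ψ : ℝ → ℝ) (e : Fin 4) : ℝ → ℝ := ![φ, ψ, φ, ψ] e

theorem tensorWavelet_eq (φ ψ : ℝ → ℝ) (j : ℤ) (k : ℤ × ℤ) (e : Fin 4) (z : ℝ × ℝ) :
    tensorWavelet φ ψ (j, k, e) z =
      dilate (firstFactor φ ψ e) j k.1 z.1 * dilate (secondFactor φ ψ e) j k.2 z.2 := by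
  obtain ⟨kx, ky⟩ := k
  fin_cases e <;> rfl

theorem two_rpow_half_mul_self (l : ℤ) :
    (2 : ℝ) ^ ((l : ℝ) / 2) * (2 : ℝ) ^ ((l : ℝ) / 2) = (2 : ℝ) ^ l := by
  rw [← Real.rpow_add two_pos, add_halves, Real.rpow_intCast]

theorem dilate_add_scale (f : ℝ → ℝ) (j l k : ℤ) (x : ℝ) :
    dilate f (j + l) k x = (2 : ℝ) ^ ((l : ℝ) / 2) * dilate f j k ((2 : ℝ) ^ l * x) := by
  unfold dilate
  rw [← mul_assoc, ← mul_assoc, ← zpow_add₀ two_ne_zero, Int.cast_add, add_div,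
    Real.rpow_add two_pos, mul_comm ((2 : ℝ) ^ ((l : ℝ) / 2))]

theorem integral_dilate_mul_dilate_add (f g : ℝ → ℝ) (j j' k k' l : ℤ) :
    ∫ x, dilate f (j + l) k x * dilate g (j' + l) k' x =
      ∫ x, dilate f j k x * dilate g j' k' x := by
  have hl : (0 : ℝ) < 2 ^ l := by positivity
  calc ∫ x, dilate f (j + l) k x * dilate g (j' + l) k' x
      = ∫ x, (2 : ℝ) ^ l * (dilate f j k ((2 : ℝ) ^ l * x) * dilate g j' k' ((2 : ℝ) ^ l * x)) := by
        congr 1; ext x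
        rw [dilate_add_scale, dilate_add_scale, ← two_rpow_half_mul_self]; ring
    _ = _ := by
        rw [integral_const_mul,
          Measure.integral_comp_mul_left (fun x => dilate f j k x * dilate g j' k' x), smul_eq_mul,
          abs_of_pos (inv_pos.2 hl), mul_inv_cancel_left₀ hl.ne']

theorem continuous_dilate {f : ℝ → ℝ} (hf : Continuous f) (j k : ℤ) :
    Continuous (dilate f j k) := by
  unfold dilate; fun_prop

theorem integrable_dilate {f : ℝ → ℝ} (hf : Integrable f) (j k : ℤ) : Integrable (dilate f j k) :=
  ((hf.comp_sub_right (k : ℝ)).comp_mul_left' (by positivity : (2 : ℝ) ^ j ≠ 0)).const_mul _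

theorem memLp_dilate {f : ℝ → ℝ} (hf : Continuous f) (h2 : MemLp f 2 (volume : Measure ℝ))
    (j k : ℤ) : MemLp (dilate f j k) 2 (volume : Measure ℝ) := by
  rw [memLp_two_iff_integrable_sq (continuous_dilate hf j k).aestronglyMeasurable]
  have h := h2.integrable_sq
  refine (((h.comp_sub_right (k : ℝ)).comp_mul_left' (by positivity : (2 : ℝ) ^ j ≠ 0)).const_mul
    (((2 : ℝ) ^ ((j : ℝ) / 2)) ^ 2)).congr (ae_of_all _ fun x => ?_)
  simp only [dilate, mul_pow]

theorem dilate_zero_zero (f : ℝ → ℝ) : dilate f 0 0 = f := by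
  ext x; simp [dilate]

section WaveletPair

variable {φ ψ : ℝ → ℝ}

theorem memLp_mother (h : IsWaveletPair φ ψ) : MemLp ψ 2 (volume : Measure ℝ) := by
  rw [memLp_two_iff_integrable_sq h.contDiff_mother.continuous.aestronglyMeasurable]
  by_contra hcon
  have h1 := h.orthonormal_mother 0 0 0 0
  simp only [dilate_zero_zero, ← sq] at h1
  rw [integral_undef hcon] at h1
  simp at h1

theorem memLp_father (h : IsWaveletPair φ ψ) : MemLp φ 2 (volume : Measure ℝ) := by
  rw [memLp_two_iff_integrable_sq h.contDiff_father.continuous.aestronglyMeasurable]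
  by_contra hcon
  have h1 := h.orthonormal_father 0 0
  simp only [dilate_zero_zero, ← sq] at h1
  rw [integral_undef hcon] at h1
  simp at h1

theorem orthonormal_father_scale (h : IsWaveletPair φ ψ) (j k k' : ℤ) :
    ∫ x, dilate φ j k x * dilate φ j k' x = if k = k' then 1 else 0 := by
  have := integral_dilate_mul_dilate_add φ φ 0 0 k k' j
  rw [zero_add] at this
  rw [this, h.orthonormal_father]

/-- The father wavelets of a scale are orthogonal to the mother wavelets of all finer scales, since
these are orthogonal to the mother wavelets of the coarser scales. -/
theorem integral_father_mul_mother (h : IsWaveletPair φ ψ) {j j' : ℤ} (hj : j ≤ j') (k k' : ℤ) :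
    ∫ x, dilate φ j k x * dilate ψ j' k' x = 0 := by
  have h1 := integral_dilate_mul_dilate_add φ ψ 0 (j' - j) k k' j
  rw [zero_add, sub_add_cancel] at h1
  rw [h1]
  have hL := memLp_dilate h.contDiff_mother.continuous (memLp_mother h) (j' - j) k'
  have h2 := (h.span_father _ hL).2 (fun i l hi => by
    rw [h.orthonormal_mother, if_neg]
    rintro ⟨h3, -⟩
    omega) k
  simpa only [mul_comm] using h2

theorem continuous_firstFactor (h : IsWaveletPair φ ψ)
    (e : Fin 4) : Continuous (firstFactor φ ψ e) := by
  fin_cases e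
  exacts [h.contDiff_father.continuous, h.contDiff_father.continuous,
    h.contDiff_mother.continuous, h.contDiff_mother.continuous]

theorem continuous_secondFactor (h : IsWaveletPair φ ψ)
    (e : Fin 4) : Continuous (secondFactor φ ψ e) := by
  fin_cases e
  exacts [h.contDiff_father.continuous, h.contDiff_mother.continuous,
    h.contDiff_father.continuous, h.contDiff_mother.continuous]

theorem memLp_firstFactor (h : IsWaveletPair φ ψ)
    (e : Fin 4) : MemLp (firstFactor φ ψ e) 2 (volume : Measure ℝ) := by
  fin_cases e
  exacts [memLp_father h, memLp_father h, memLp_mother h, memLp_mother h]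

theorem memLp_secondFactor (h : IsWaveletPair φ ψ)
    (e : Fin 4) : MemLp (secondFactor φ ψ e) 2 (volume : Measure ℝ) := by
  fin_cases e
  exacts [memLp_father h, memLp_mother h, memLp_father h, memLp_mother h]

theorem memLp_tensorWavelet (h : IsWaveletPair φ ψ) (I : WaveletIndex) :
    MemLp (tensorWavelet φ ψ I) 2 (volume : Measure (ℝ × ℝ)) := by
  obtain ⟨j, k, e⟩ := I
  have h1 := memLp_dilate (continuous_firstFactor h e) (memLp_firstFactor h e) j k.1
  have h2 := memLp_dilate (continuous_secondFactor h e) (memLp_secondFactor h e) j k.2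
  have hc : Continuous (tensorWavelet φ ψ (j, k, e)) := by
    simp_rw [funext (tensorWavelet_eq φ ψ j k e)]
    exact ((continuous_dilate (continuous_firstFactor h e) _ _).comp continuous_fst).mul
      ((continuous_dilate (continuous_secondFactor h e) _ _).comp continuous_snd)
  rw [memLp_two_iff_integrable_sq hc.aestronglyMeasurable]
  refine (h1.integrable_sq.mul_prod h2.integrable_sq).congr (ae_of_all _ fun z => ?_)
  simp only [tensorWavelet_eq, mul_pow]

/-- Orthonormality within one scale, for the possible pairs of one-dimensional factors. -/
theorem integral_factors_same_scale (h : IsWaveletPair φ ψ) (j : ℤ) (k k' : ℤ × ℤ) (e e' : Fin 4) :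
    (∫ x, dilate (firstFactor φ ψ e) j k.1 x * dilate (firstFactor φ ψ e') j k'.1 x) *
      (∫ x, dilate (secondFactor φ ψ e) j k.2 x * dilate (secondFactor φ ψ e') j k'.2 x) =
      if k = k' ∧ e = e' then 1 else 0 := by
  have a1 := fun k k' => orthonormal_father_scale h j k k'
  have a2 := fun k k' => h.orthonormal_mother j k j k'
  have a3 := fun k k' => integral_father_mul_mother h (le_refl j) k k'
  have a4 : ∀ k k', ∫ x, dilate ψ j k x * dilate φ j k' x = 0 := fun k k' => by
    rw [← integral_father_mul_mother h (le_refl j) k' k]; simp only [mul_comm]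
  fin_cases e <;> fin_cases e' <;>
    simp [firstFactor, secondFactor, a1, a2, a3, a4, Prod.ext_iff, ← ite_and, and_comm]

theorem integral_factors_of_lt (h : IsWaveletPair φ ψ)
    {j j' : ℤ} (hj : j < j') (k k' : ℤ × ℤ) (e : Fin 4) {e' : Fin 4}
    (he' : e' ≠ 0) :
    (∫ x, dilate (firstFactor φ ψ e) j k.1 x * dilate (firstFactor φ ψ e') j' k'.1 x) *
      (∫ x, dilate (secondFactor φ ψ e) j k.2 x * dilate (secondFactor φ ψ e') j' k'.2 x) = 0 := by
  have a2 : ∀ k k', ∫ x, dilate ψ j k x * dilate ψ j' k' x = 0 := fun k k' => by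
    rw [h.orthonormal_mother, if_neg]; rintro ⟨h1, -⟩; omega
  have a3 := fun k k' => integral_father_mul_mother h hj.le k k'
  fin_cases e' <;> fin_cases e <;> simp_all [firstFactor, secondFactor]

theorem integral_tensorWavelet_mul (h : IsWaveletPair φ ψ)
    {D : Set (ℝ × ℝ)} {j₁ j₀ : ℤ} {I J : WaveletIndex}
    (hI : I ∈ allIndices D j₁ j₀) (hJ : J ∈ allIndices D j₁ j₀) :
    ∫ z, tensorWavelet φ ψ I z * tensorWavelet φ ψ J z = if I = J then 1 else 0 := by
  wlog hle : I.1 ≤ J.1 generalizing I J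
  · simp_rw [mul_comm (tensorWavelet φ ψ I _), this hJ hI (le_of_not_ge hle), eq_comm]
  obtain ⟨j, k, e⟩ := I
  obtain ⟨j', k', e'⟩ := J
  have hprod : ∫ z, tensorWavelet φ ψ (j, k, e) z * tensorWavelet φ ψ (j', k', e') z =
      (∫ x, dilate (firstFactor φ ψ e) j k.1 x * dilate (firstFactor φ ψ e') j' k'.1 x) *
      (∫ x, dilate (secondFactor φ ψ e) j k.2 x * dilate (secondFactor φ ψ e') j' k'.2 x) := by
    rw [← integral_prod_mul]
    refine integral_congr_ae (ae_of_all _ fun z => ?_)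
    simp only [tensorWavelet_eq]; ring
  rw [hprod]
  simp only at hle
  rcases hle.eq_or_lt with rfl | hlt
  · rw [integral_factors_same_scale h]
    simp
  · have he' : e' ≠ 0 := by
      rintro rfl
      rcases hJ with hJ | hJ
      · have h1 : j' = j₁ := hJ.1
        have h2 : j₁ ≤ j := by
          rcases hI with hI | hI
          exacts [hI.1.ge, hI.1]
        omega
      · exact hJ.2.2.1 rfl
    rw [integral_factors_of_lt h hlt k k' e he', if_neg]
    intro heq
    rw [Prod.mk.injEq] at heq
    omega

theorem distSq_combination (h : IsWaveletPair φ ψ) {D : Set (ℝ × ℝ)} {j₁ j₀ : ℤ} {f : ℝ × ℝ → ℝ}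
    (hf : MemLp f 2 (volume : Measure (ℝ × ℝ))) {m : Finset WaveletIndex}
    (hm : (m : Set WaveletIndex) ⊆ allIndices D j₁ j₀) (c : WaveletIndex → ℝ) :
    distSq f (combination φ ψ m c) =
      (∫ z, f z ^ 2) - 2 * ∑ I ∈ m, c I * (∫ z, f z * tensorWavelet φ ψ I z) +
        ∑ I ∈ m, c I ^ 2 := by
  have hΨ := memLp_tensorWavelet h
  have i1 : Integrable fun z => f z ^ 2 := hf.integrable_sq
  have i2 : ∀ I ∈ m, Integrable fun z => c I * (f z * tensorWavelet φ ψ I z) := fun I _ =>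
    (hf.integrable_mul (hΨ I)).const_mul _
  have i3 : ∀ I ∈ m, ∀ J ∈ m, Integrable fun z =>
      c I * c J * (tensorWavelet φ ψ I z * tensorWavelet φ ψ J z) := fun I _ J _ =>
    ((hΨ I).integrable_mul (hΨ J)).const_mul _
  have i2' : Integrable fun z => 2 * ∑ I ∈ m, c I * (f z * tensorWavelet φ ψ I z) :=
    (integrable_finsetSum _ i2).const_mul _
  have i3' : Integrable fun z => ∑ I ∈ m, ∑ J ∈ m,
      c I * c J * (tensorWavelet φ ψ I z * tensorWavelet φ ψ J z) :=
    integrable_finsetSum _ fun I hI => integrable_finsetSum _ (i3 I hI)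
  have hexp : ∀ z, (f z - combination φ ψ m c z) ^ 2 =
      f z ^ 2 - 2 * ∑ I ∈ m, c I * (f z * tensorWavelet φ ψ I z) +
        ∑ I ∈ m, ∑ J ∈ m, c I * c J * (tensorWavelet φ ψ I z * tensorWavelet φ ψ J z) := by
    intro z
    have e1 : ∑ I ∈ m, c I * (f z * tensorWavelet φ ψ I z) = f z * combination φ ψ m c z := by
      rw [combination, Finset.mul_sum]
      exact Finset.sum_congr rfl fun I _ => by ring
    have e2 : ∑ I ∈ m, ∑ J ∈ m, c I * c J * (tensorWavelet φ ψ I z * tensorWavelet φ ψ J z) =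
        combination φ ψ m c z * combination φ ψ m c z := by
      rw [combination, Finset.sum_mul_sum]
      exact Finset.sum_congr rfl fun I _ => Finset.sum_congr rfl fun J _ => by ring
    rw [e1, e2]; ring
  have hdiag : ∫ z, ∑ I ∈ m, ∑ J ∈ m,
      c I * c J * (tensorWavelet φ ψ I z * tensorWavelet φ ψ J z) = ∑ I ∈ m, c I ^ 2 := by
    rw [integral_finsetSum _ fun I hI => integrable_finsetSum _ (i3 I hI)]
    refine Finset.sum_congr rfl fun I hI => ?_
    rw [integral_finsetSum _ (i3 I hI)]
    calc ∑ J ∈ m, ∫ z, c I * c J * (tensorWavelet φ ψ I z * tensorWavelet φ ψ J z)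
        = ∑ J ∈ m, if I = J then c I * c J else 0 := by
          refine Finset.sum_congr rfl fun J hJ => ?_
          rw [integral_const_mul, integral_tensorWavelet_mul h (hm hI) (hm hJ)]
          simp
      _ = c I ^ 2 := by rw [Finset.sum_ite_eq, if_pos hI, sq]
  unfold distSq
  simp_rw [hexp]
  have i12 : Integrable fun z => f z ^ 2 - 2 * ∑ I ∈ m, c I * (f z * tensorWavelet φ ψ I z) :=
    i1.sub i2'
  rw [integral_add i12 i3', integral_sub i1 i2', hdiag, integral_const_mul,
    integral_finsetSum _ i2]
  simp_rw [integral_const_mul]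

theorem empContrast_empCoeff (h : IsWaveletPair φ ψ)
    {D : Set (ℝ × ℝ)} {j₁ j₀ : ℤ} {n : ℕ} (s : Fin n → ℝ × ℝ)
    {m : Finset WaveletIndex} (hm : (m : Set WaveletIndex) ⊆ allIndices D j₁ j₀) :
    empContrast φ ψ s m (empCoeff φ ψ s) = -∑ I ∈ m, empCoeff φ ψ s I ^ 2 := by
  have h1 : distSq (combination φ ψ m (empCoeff φ ψ s)) 0 = ∑ I ∈ m, empCoeff φ ψ s I ^ 2 := by
    have := distSq_combination h (MemLp.zero : MemLp (0 : ℝ × ℝ → ℝ) 2 volume) hm (empCoeff φ ψ s)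
    rw [show distSq (combination φ ψ m (empCoeff φ ψ s)) 0 =
      distSq 0 (combination φ ψ m (empCoeff φ ψ s)) by simp [distSq], this]
    simp
  rw [empContrast, h1]
  simp_rw [← sq]
  ring

theorem le_biasSq (h : IsWaveletPair φ ψ) {D : Set (ℝ × ℝ)} {j₁ j₀ : ℤ} {f : ℝ × ℝ → ℝ}
    (hf : MemLp f 2 (volume : Measure (ℝ × ℝ))) {m : Finset WaveletIndex}
    (hm : (m : Set WaveletIndex) ⊆ allIndices D j₁ j₀) :
    (∫ z, f z ^ 2) - ∑ I ∈ m, (∫ z, f z * tensorWavelet φ ψ I z) ^ 2 ≤ biasSq φ ψ f m := by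
  refine le_ciInf fun c => ?_
  rw [distSq_combination h hf hm, Finset.mul_sum, sub_add, ← Finset.sum_sub_distrib]
  refine sub_le_sub_left (Finset.sum_le_sum fun I _ => ?_) _
  nlinarith [sq_nonneg (c I - ∫ z, f z * tensorWavelet φ ψ I z)]

/-- Bessel's inequality. -/
theorem sum_integral_mul_tensorWavelet_sq_le (h : IsWaveletPair φ ψ)
    {D : Set (ℝ × ℝ)} {j₁ j₀ : ℤ} {f : ℝ × ℝ → ℝ}
    (hf : MemLp f 2 (volume : Measure (ℝ × ℝ))) {m : Finset WaveletIndex}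
    (hm : (m : Set WaveletIndex) ⊆ allIndices D j₁ j₀) :
    ∑ I ∈ m, (∫ z, f z * tensorWavelet φ ψ I z) ^ 2 ≤ ∫ z, f z ^ 2 := by
  have h1 := distSq_combination h hf hm (fun I => ∫ z, f z * tensorWavelet φ ψ I z)
  have h2 : 0 ≤ distSq f (combination φ ψ m (fun I => ∫ z, f z * tensorWavelet φ ψ I z)) :=
    integral_nonneg fun z => sq_nonneg _
  simp_rw [← sq] at h1
  linarith

end WaveletPair

/-! ### The one-dimensional Fourier transform of smooth functions -/

/-- The Fourier transform `u ↦ ∫ f(x) exp(-iux) dx` in one dimension, normalized as `fourier2`. -/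
noncomputable def fourier1 (f : ℝ → ℝ) (u : ℝ) : ℂ :=
  ∫ x : ℝ, (f x : ℂ) * Complex.exp (-Complex.I * ((u * x : ℝ) : ℂ))

theorem norm_exp_neg_I_mul (t : ℝ) : ‖Complex.exp (-Complex.I * (t : ℂ))‖ = 1 := by
  rw [show -Complex.I * (t : ℂ) = ((-t : ℝ) : ℂ) * Complex.I by push_cast; ring,
    Complex.norm_exp_ofReal_mul_I]

theorem norm_exp_I_mul (t : ℝ) : ‖Complex.exp (Complex.I * (t : ℂ))‖ = 1 := by
  rw [mul_comm, Complex.norm_exp_ofReal_mul_I]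

open scoped FourierTransform in
theorem fourier1_eq_fourier (f : ℝ → ℝ) (u : ℝ) :
    fourier1 f u = 𝓕 (fun x : ℝ => (f x : ℂ)) (u / (2 * Real.pi)) := by
  rw [Real.fourier_real_eq_integral_exp_smul, fourier1]
  refine integral_congr_ae (ae_of_all _ fun x => ?_)
  simp only [smul_eq_mul]
  rw [mul_comm]
  congr 2
  have : Real.pi ≠ 0 := Real.pi_ne_zero
  rw [show -2 * Real.pi * x * (u / (2 * Real.pi)) = -(u * x) by field_simp]
  push_cast; ring

theorem continuous_fourier1 {f : ℝ → ℝ} (hf : Integrable f) : Continuous (fourier1 f) := by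
  have hc : Integrable fun x => (f x : ℂ) := hf.ofReal
  refine continuous_of_dominated (bound := fun x => ‖f x‖) (fun u => ?_) (fun u => ?_) hf.norm ?_
  · exact hc.aestronglyMeasurable.mul (by fun_prop : Continuous fun x : ℝ =>
      Complex.exp (-Complex.I * ((u * x : ℝ) : ℂ))).aestronglyMeasurable
  · refine ae_of_all _ fun x => ?_
    rw [norm_mul, norm_exp_neg_I_mul, mul_one, Complex.norm_real]
  · exact ae_of_all _ fun x => by fun_prop

theorem fourier2_tensor (f g : ℝ → ℝ) (w : ℝ × ℝ) :
    fourier2 (fun z => ((f z.1 * g z.2 : ℝ) : ℂ)) w = fourier1 f w.1 * fourier1 g w.2 := by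
  unfold fourier2 fourier1
  rw [← integral_prod_mul]
  refine integral_congr_ae (ae_of_all _ fun z => ?_)
  simp only
  rw [mul_mul_mul_comm, ← Complex.exp_add]
  push_cast
  rw [mul_add]

/-- Continuous integrable functions whose Fourier transform decays cubically. -/
structure HasCubicDecay (f : ℝ → ℝ) : Prop where
  continuous : Continuous f
  integrable : Integrable f
  decay : ∃ C : ℝ, ∀ u : ℝ, ‖fourier1 f u‖ * (1 + |u|) ^ 3 ≤ C

theorem iteratedDeriv_ofReal_comp {f : ℝ → ℝ} {N : ℕ} (hf : ContDiff ℝ N f) {i : ℕ} (hi : i ≤ N) :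
    iteratedDeriv i (fun x => (f x : ℂ)) = fun x => ((iteratedDeriv i f x : ℝ) : ℂ) := by
  induction i with
  | zero => simp
  | succ i ih =>
    rw [iteratedDeriv_succ, ih (by omega)]
    ext x
    have hd : DifferentiableAt ℝ (iteratedDeriv i f) x :=
      (hf.differentiable_iteratedDeriv i (by exact_mod_cast hi)) x
    rw [iteratedDeriv_succ]
    exact hd.hasDerivAt.ofReal_comp.deriv

theorem norm_fourier1_le (f : ℝ → ℝ) (u : ℝ) : ‖fourier1 f u‖ ≤ ∫ x, ‖f x‖ := by
  refine (norm_integral_le_integral_norm _).trans (le_of_eq ?_)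
  refine integral_congr_ae (ae_of_all _ fun x => ?_)
  simp only
  rw [norm_mul, norm_exp_neg_I_mul, mul_one, Complex.norm_real]

open scoped FourierTransform in
theorem HasCubicDecay.of_contDiff {f : ℝ → ℝ} (hf : ContDiff ℝ 3 f)
    (hi : ∀ i : ℕ, i ≤ 3 → Integrable (iteratedDeriv i f)) : HasCubicDecay f := by
  have hf0 : Integrable f := by simpa using hi 0 (by norm_num)
  refine ⟨hf.continuous, hf0, 4 * (∫ x, ‖f x‖) + 4 * ∫ x, ‖iteratedDeriv 3 f x‖, fun u => ?_⟩
  have hc : ContDiff ℝ ((3 : ℕ∞) : WithTop ℕ∞) (fun x => (f x : ℂ)) :=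
    Complex.ofRealCLM.contDiff.comp hf
  have hF := Real.fourier_iteratedDeriv (N := 3) (n := 3) hc (fun i hin => by
    rw [iteratedDeriv_ofReal_comp (N := 3) hf (by exact_mod_cast hin)]
    exact (hi i (by exact_mod_cast hin)).ofReal) le_rfl
  have h3 : ‖fourier1 f u‖ * |u| ^ 3 = ‖fourier1 (iteratedDeriv 3 f) u‖ := by
    rw [fourier1_eq_fourier (iteratedDeriv 3 f),
      ← iteratedDeriv_ofReal_comp (N := 3) (i := 3) hf le_rfl, hF, fourier1_eq_fourier f]
    rw [norm_smul, norm_pow, mul_comm]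
    congr 2
    have : (2 * Real.pi * Complex.I * ((u / (2 * Real.pi) : ℝ) : ℂ)) = (u : ℂ) * Complex.I := by
      have : (Real.pi : ℂ) ≠ 0 := by exact_mod_cast Real.pi_ne_zero
      push_cast; field_simp
    rw [this]; simp
  have h0 := norm_fourier1_le f u
  have h1 := norm_fourier1_le (iteratedDeriv 3 f) u
  have hb : (1 + |u|) ^ 3 ≤ 4 * (1 + |u| ^ 3) := by
    have := abs_nonneg u
    nlinarith [mul_nonneg (add_nonneg zero_le_one this) (sq_nonneg (1 - |u|))]
  calc ‖fourier1 f u‖ * (1 + |u|) ^ 3 ≤ ‖fourier1 f u‖ * (4 * (1 + |u| ^ 3)) := by gcongr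
    _ = 4 * ‖fourier1 f u‖ + 4 * (‖fourier1 f u‖ * |u| ^ 3) := by ring
    _ ≤ _ := by rw [h3]; gcongr

theorem fourier1_dilate (f : ℝ → ℝ) (j k : ℤ) (u : ℝ) :
    fourier1 (dilate f j k) u = (((2 : ℝ) ^ (-(j : ℝ) / 2) : ℝ) : ℂ) *
      Complex.exp (-Complex.I * (((2 : ℝ) ^ (-j) * u * k : ℝ) : ℂ)) *
        fourier1 f ((2 : ℝ) ^ (-j) * u) := by
  have hj : (0 : ℝ) < 2 ^ j := by positivity
  have h2 : (2 : ℝ) ^ ((j : ℝ) / 2) * (2 ^ j)⁻¹ = (2 : ℝ) ^ (-(j : ℝ) / 2) := by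
    rw [← Real.rpow_intCast, ← Real.rpow_neg zero_le_two, ← Real.rpow_add two_pos]
    congr 1; ring
  set a : ℂ := (((2 : ℝ) ^ ((j : ℝ) / 2) : ℝ) : ℂ)
  set F : ℝ → ℂ :=
    fun x => (f x : ℂ) * Complex.exp (-Complex.I * (((2 : ℝ) ^ (-j) * u * x : ℝ) : ℂ))
  calc fourier1 (dilate f j k) u
      = ∫ x, a * Complex.exp (-Complex.I * (((2 : ℝ) ^ (-j) * u * k : ℝ) : ℂ)) *
          F ((2 : ℝ) ^ j * x - k) := by
        refine integral_congr_ae (ae_of_all _ fun x => ?_)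
        simp only [F, a, dilate]
        have e : u * x = (2 : ℝ) ^ (-j) * u * k + (2 : ℝ) ^ (-j) * u * ((2 : ℝ) ^ j * x - k) := by
          rw [zpow_neg]; field_simp; ring
        rw [e]
        push_cast
        rw [mul_add, Complex.exp_add]
        ring
    _ = _ := by
        rw [integral_const_mul, Measure.integral_comp_mul_left (fun x => F (x - k)),
          integral_sub_right_eq_self, abs_of_pos (inv_pos.2 hj), ← h2]
        simp only [F, a, fourier1, Complex.real_smul]
        push_cast
        ring

theorem HasCubicDecay.dilate {f : ℝ → ℝ} (hf : HasCubicDecay f) (j k : ℤ) :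
    HasCubicDecay (dilate f j k) := by
  obtain ⟨C, hC⟩ := hf.decay
  refine ⟨continuous_dilate hf.continuous j k, integrable_dilate hf.integrable j k,
    (2 : ℝ) ^ (-(j : ℝ) / 2) * (C * (1 + 2 ^ j) ^ 3), fun u => ?_⟩
  rw [fourier1_dilate, norm_mul, norm_mul, norm_exp_neg_I_mul, mul_one, Complex.norm_real,
    Real.norm_of_nonneg (by positivity), mul_assoc]
  refine mul_le_mul_of_nonneg_left ?_ (by positivity)
  have hj : (0 : ℝ) < 2 ^ j := by positivity
  have hu : |u| = 2 ^ j * |2 ^ (-j) * u| := by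
    rw [abs_mul, abs_of_pos (by positivity : (0 : ℝ) < 2 ^ (-j)), zpow_neg]; field_simp
  have h1 : 1 + |u| ≤ (1 + |2 ^ (-j) * u|) * (1 + 2 ^ j) := by
    rw [hu]; nlinarith [abs_nonneg ((2 : ℝ) ^ (-j) * u)]
  calc ‖fourier1 f (2 ^ (-j) * u)‖ * (1 + |u|) ^ 3
      ≤ ‖fourier1 f (2 ^ (-j) * u)‖ * ((1 + |2 ^ (-j) * u|) * (1 + 2 ^ j)) ^ 3 := by gcongr
    _ = ‖fourier1 f (2 ^ (-j) * u)‖ * (1 + |2 ^ (-j) * u|) ^ 3 * (1 + 2 ^ j) ^ 3 := by ring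
    _ ≤ C * (1 + 2 ^ j) ^ 3 := by gcongr; exact hC _

theorem HasCubicDecay.norm_fourier1_le_inv {f : ℝ → ℝ} (hf : HasCubicDecay f) :
    ∃ C : ℝ, 0 ≤ C ∧ ∀ u, ‖fourier1 f u‖ ≤ C * (1 + u ^ 2)⁻¹ := by
  obtain ⟨C, hC⟩ := hf.decay
  have hC0 : 0 ≤ C := le_trans (by positivity) (hC 0)
  refine ⟨C, hC0, fun u => ?_⟩
  rw [← div_eq_mul_inv, le_div_iff₀ (by positivity)]
  refine le_trans ?_ (hC u)
  gcongr
  rw [← sq_abs]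
  have := abs_nonneg u
  nlinarith [pow_nonneg this 3, pow_nonneg this 2]

theorem HasCubicDecay.integrable_fourier1 {f : ℝ → ℝ} (hf : HasCubicDecay f) :
    Integrable (fourier1 f) := by
  obtain ⟨C, -, hC⟩ := hf.norm_fourier1_le_inv
  exact (integrable_inv_one_add_sq.const_mul C).mono'
    (continuous_fourier1 hf.integrable).aestronglyMeasurable (ae_of_all _ hC)

theorem HasCubicDecay.integrable_norm_fourier1_sq {f : ℝ → ℝ} (hf : HasCubicDecay f) :
    Integrable fun u => ‖fourier1 f u‖ ^ 2 := by
  obtain ⟨C, hC0, hC⟩ := hf.norm_fourier1_le_inv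
  refine (hf.integrable_fourier1.norm.const_mul C).mono'
    ((continuous_fourier1 hf.integrable).norm.pow 2).aestronglyMeasurable (ae_of_all _ fun u => ?_)
  rw [Real.norm_of_nonneg (by positivity), sq]
  gcongr
  refine (hC u).trans (mul_le_of_le_one_right hC0 (inv_le_one_of_one_le₀ ?_))
  nlinarith [sq_nonneg u]

open scoped FourierTransform in
/-- Fourier inversion. -/
theorem HasCubicDecay.integral_fourier1_mul_exp {f : ℝ → ℝ} (hf : HasCubicDecay f) (x : ℝ) :
    ∫ u, fourier1 f u * Complex.exp (Complex.I * ((x * u : ℝ) : ℂ)) = 2 * Real.pi * (f x : ℂ) := by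
  have hpi : (0 : ℝ) < 2 * Real.pi := by positivity
  have hF : ∀ v : ℝ, 𝓕 (fun x : ℝ => (f x : ℂ)) v = fourier1 f (2 * Real.pi * v) := fun v => by
    rw [fourier1_eq_fourier, mul_div_cancel_left₀ _ hpi.ne']
  have hint : Integrable (𝓕 (fun x : ℝ => (f x : ℂ))) := by
    rw [funext hF]
    exact hf.integrable_fourier1.comp_mul_left' hpi.ne'
  have hc : Continuous fun x => (f x : ℂ) := Complex.continuous_ofReal.comp hf.continuous
  have hinv := congrFun (hc.fourierInv_fourier_eq hf.integrable.ofReal hint) x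
  rw [Real.fourierInv_eq'] at hinv
  set G : ℝ → ℂ := fun u => fourier1 f u * Complex.exp (Complex.I * ((x * u : ℝ) : ℂ))
  have hG : ∫ v, G (2 * Real.pi * v) = (f x : ℂ) := by
    rw [← hinv]
    refine integral_congr_ae (ae_of_all _ fun v => ?_)
    simp only [G, hF, smul_eq_mul]
    rw [mul_comm]
    congr 2
    simp only [RCLike.inner_apply, conj_trivial]
    push_cast; ring
  rw [Measure.integral_comp_mul_left G, abs_of_pos (inv_pos.2 hpi), Complex.real_smul] at hG
  rw [← hG]
  have : (Real.pi : ℂ) ≠ 0 := by exact_mod_cast Real.pi_ne_zero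
  push_cast; field_simp

/-! ### The dual functions -/

/-- The Fourier transform of `f ⊗ g` along the ray of direction `θ`, with the weight `|u|` of the
inverse Radon transform. -/
noncomputable def radialKernel (f g : ℝ → ℝ) (u θ : ℝ) : ℂ :=
  ((|u| : ℝ) : ℂ) * (fourier1 f (u * Real.cos θ) * fourier1 g (u * Real.sin θ))

theorem continuous_radialKernel {f g : ℝ → ℝ} (hf : Integrable f) (hg : Integrable g) :
    Continuous fun q : ℝ × ℝ => radialKernel f g q.1 q.2 := by
  have h1 := continuous_fourier1 hf
  have h2 := continuous_fourier1 hg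
  unfold radialKernel
  fun_prop

theorem one_le_abs_cos_add_abs_sin (θ : ℝ) : 1 ≤ |Real.cos θ| + |Real.sin θ| := by
  have h1 := Real.sin_sq_add_cos_sq θ
  have h2 := abs_nonneg (Real.cos θ)
  have h3 := abs_nonneg (Real.sin θ)
  rw [← sq_abs, ← sq_abs (Real.cos θ)] at h1
  nlinarith [Real.abs_cos_le_one θ, Real.abs_sin_le_one θ]

/-- In every direction one of the two factors decays; the bound is uniform in the direction. -/
theorem exists_norm_radialKernel_le {f g : ℝ → ℝ} (hf : HasCubicDecay f) (hg : HasCubicDecay g) :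
    ∃ C : ℝ, 0 ≤ C ∧ ∀ u θ, ‖radialKernel f g u θ‖ ≤ C * (1 + u ^ 2)⁻¹ := by
  obtain ⟨C, hC⟩ := hf.decay
  obtain ⟨C', hC'⟩ := hg.decay
  have hC0 : 0 ≤ C := le_trans (by positivity) (hC 0)
  have hC0' : 0 ≤ C' := le_trans (by positivity) (hC' 0)
  refine ⟨C * C', by positivity, fun u θ => ?_⟩
  set c := |u * Real.cos θ|
  set s := |u * Real.sin θ|
  have hc0 : 0 ≤ c := abs_nonneg _
  have hs0 : 0 ≤ s := abs_nonneg _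
  have hcs : |u| ≤ c + s := by
    simp only [c, s, abs_mul]
    nlinarith [one_le_abs_cos_add_abs_sin θ, abs_nonneg u]
  have hu := abs_nonneg u
  have h1 : |u| * (1 + u ^ 2) ≤ ((1 + c) * (1 + s)) ^ 3 := by
    calc |u| * (1 + u ^ 2) ≤ (1 + |u|) ^ 3 := by
          rw [← sq_abs]; nlinarith [pow_nonneg hu 2]
      _ ≤ _ := by gcongr; nlinarith [mul_nonneg hc0 hs0]
  rw [← div_eq_mul_inv, le_div_iff₀ (by positivity), radialKernel, norm_mul, norm_mul,
    Complex.norm_real, Real.norm_eq_abs, abs_abs]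
  calc |u| * (‖fourier1 f (u * Real.cos θ)‖ * ‖fourier1 g (u * Real.sin θ)‖) * (1 + u ^ 2)
      = |u| * (1 + u ^ 2) * (‖fourier1 f (u * Real.cos θ)‖ * ‖fourier1 g (u * Real.sin θ)‖) := by
              ring
    _ ≤ ((1 + c) * (1 + s)) ^ 3 *
        (‖fourier1 f (u * Real.cos θ)‖ * ‖fourier1 g (u * Real.sin θ)‖) := by gcongr
    _ = (‖fourier1 f (u * Real.cos θ)‖ * (1 + c) ^ 3) *
        (‖fourier1 g (u * Real.sin θ)‖ * (1 + s) ^ 3) := by ring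
    _ ≤ C * C' := mul_le_mul (hC _) (hC' _) (by positivity) hC0

/-- The filtered back-projection kernel of `f ⊗ g`, before taking the real part and normalizing. -/
noncomputable def backKernel (f g : ℝ → ℝ) (x θ : ℝ) : ℂ :=
  ∫ u : ℝ, radialKernel f g u θ * Complex.exp (Complex.I * ((x * u : ℝ) : ℂ))

theorem dualFun_eq (φ ψ : ℝ → ℝ) (j : ℤ) (k : ℤ × ℤ) (e : Fin 4) (x θ : ℝ) :
    dualFun φ ψ (j, k, e) x θ = (1 / (4 * Real.pi)) *
      (backKernel (dilate (firstFactor φ ψ e) j k.1)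
        (dilate (secondFactor φ ψ e) j k.2) x θ).re := by
  unfold dualFun backKernel radialKernel
  simp_rw [tensorWavelet_eq, fourier2_tensor]

theorem measurable_backKernel {f g : ℝ → ℝ} (hf : Integrable f) (hg : Integrable g) :
    Measurable fun z : ℝ × ℝ => backKernel f g z.1 z.2 := by
  have hc : Continuous fun q : (ℝ × ℝ) × ℝ =>
      radialKernel f g q.2 q.1.2 * Complex.exp (Complex.I * ((q.1.1 * q.2 : ℝ) : ℂ)) := by
    refine ((continuous_radialKernel hf hg).comp
      (by fun_prop : Continuous fun q : (ℝ × ℝ) × ℝ => (q.2, q.1.2))).mul ?_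
    fun_prop
  exact (StronglyMeasurable.integral_prod_right (ν := (volume : Measure ℝ))
    (f := fun (z : ℝ × ℝ) (u : ℝ) => radialKernel f g u z.2 *
      Complex.exp (Complex.I * ((z.1 * u : ℝ) : ℂ))) hc.stronglyMeasurable).measurable

theorem backKernel_dilate (f g : ℝ → ℝ) (j k l : ℤ) (x θ : ℝ) :
    backKernel (dilate f j k) (dilate g j l) x θ = ((2 : ℝ) ^ j : ℝ) *
      backKernel f g ((2 : ℝ) ^ j * x - (k * Real.cos θ + l * Real.sin θ)) θ := by
  have hj : (0 : ℝ) < 2 ^ j := by positivity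
  have hpow : (2 : ℝ) ^ (-(j : ℝ) / 2) * (2 : ℝ) ^ (-(j : ℝ) / 2) * 2 ^ j = 1 := by
    rw [← Real.rpow_intCast, ← Real.rpow_add two_pos, ← Real.rpow_add two_pos]
    rw [show -(j : ℝ) / 2 + -(j : ℝ) / 2 + j = 0 by ring, Real.rpow_zero]
  have hinv : (2 : ℝ) ^ (-j) = (2 ^ j)⁻¹ := zpow_neg _ _
  set G : ℝ → ℂ := fun u => radialKernel f g u θ * Complex.exp (Complex.I *
    ((((2 : ℝ) ^ j * x - (k * Real.cos θ + l * Real.sin θ)) * u : ℝ) : ℂ))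
  have h1 : ∀ u, radialKernel (dilate f j k) (dilate g j l) u θ *
      Complex.exp (Complex.I * ((x * u : ℝ) : ℂ)) = G ((2 ^ j)⁻¹ * u) := by
    intro u
    simp only [G, radialKernel, fourier1_dilate]
    rw [hinv, abs_mul, abs_of_pos (inv_pos.2 hj)]
    have e1 : Complex.exp (Complex.I *
        ((((2 : ℝ) ^ j * x - (k * Real.cos θ + l * Real.sin θ)) * ((2 ^ j)⁻¹ * u) : ℝ) : ℂ)) =
        Complex.exp (-Complex.I * (((2 ^ j)⁻¹ * (u * Real.cos θ) * k : ℝ) : ℂ)) *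
        Complex.exp (-Complex.I * (((2 ^ j)⁻¹ * (u * Real.sin θ) * l : ℝ) : ℂ)) *
        Complex.exp (Complex.I * ((x * u : ℝ) : ℂ)) := by
      rw [← Complex.exp_add, ← Complex.exp_add]
      congr 1
      have : (((2 : ℝ) ^ j * x - (k * Real.cos θ + l * Real.sin θ)) * ((2 ^ j)⁻¹ * u) : ℝ) =
        -((2 ^ j)⁻¹ * (u * Real.cos θ) * k) - ((2 ^ j)⁻¹ * (u * Real.sin θ) * l) + x * u := by
        field_simp; ring
      rw [this]
      push_cast; ring
    have e2 : ((((2 : ℝ) ^ j)⁻¹ * |u| : ℝ) : ℂ) = (((2 : ℝ) ^ (-(j : ℝ) / 2) : ℝ) : ℂ) *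
        (((2 : ℝ) ^ (-(j : ℝ) / 2) : ℝ) : ℂ) * ((|u| : ℝ) : ℂ) := by
      rw [← Complex.ofReal_mul, ← Complex.ofReal_mul, ← eq_inv_of_mul_eq_one_left hpow]
    rw [e1, e2, ← mul_assoc ((2 : ℝ) ^ j)⁻¹, ← mul_assoc ((2 : ℝ) ^ j)⁻¹]
    ring
  unfold backKernel
  rw [funext h1, Measure.integral_comp_mul_left G, inv_inv, abs_of_pos hj, Complex.real_smul]

theorem exists_norm_backKernel_le {f g : ℝ → ℝ} (hf : HasCubicDecay f) (hg : HasCubicDecay g) :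
    ∃ C : ℝ, ∀ x θ, ‖backKernel f g x θ‖ ≤ C := by
  obtain ⟨C, -, hC⟩ := exists_norm_radialKernel_le hf hg
  refine ⟨∫ u : ℝ, C * (1 + u ^ 2)⁻¹, fun x θ => ?_⟩
  refine norm_integral_le_of_norm_le (integrable_inv_one_add_sq.const_mul C)
    (ae_of_all _ fun u => ?_)
  rw [norm_mul, norm_exp_I_mul, mul_one]
  exact hC u θ

section WaveletPair

variable {φ ψ : ℝ → ℝ}

theorem hasCubicDecay_firstFactor (h : IsWaveletPair φ ψ) (e : Fin 4) :
    HasCubicDecay (firstFactor φ ψ e) := by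
  have h1 := HasCubicDecay.of_contDiff h.contDiff_father h.integrable_father
  have h2 := HasCubicDecay.of_contDiff h.contDiff_mother h.integrable_mother
  fin_cases e
  exacts [h1, h1, h2, h2]

theorem hasCubicDecay_secondFactor (h : IsWaveletPair φ ψ) (e : Fin 4) :
    HasCubicDecay (secondFactor φ ψ e) := by
  have h1 := HasCubicDecay.of_contDiff h.contDiff_father h.integrable_father
  have h2 := HasCubicDecay.of_contDiff h.contDiff_mother h.integrable_mother
  fin_cases e
  exacts [h1, h2, h1, h2]

theorem measurable_dualFun (h : IsWaveletPair φ ψ) (I : WaveletIndex) :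
    Measurable fun z : ℝ × ℝ => dualFun φ ψ I z.1 z.2 := by
  obtain ⟨j, k, e⟩ := I
  simp_rw [dualFun_eq]
  exact (Complex.measurable_re.comp (measurable_backKernel
    (integrable_dilate (hasCubicDecay_firstFactor h e).integrable j k.1)
    (integrable_dilate (hasCubicDecay_secondFactor h e).integrable j k.2))).const_mul _

theorem dualSup_nonneg (φ ψ : ℝ → ℝ) (e : Fin 4) : 0 ≤ dualSup φ ψ e := by
  refine Real.sSup_nonneg ?_
  rintro _ ⟨z, -, rfl⟩
  exact abs_nonneg _

theorem abs_dualFun_le (h : IsWaveletPair φ ψ) (I : WaveletIndex) (x : ℝ) {θ : ℝ}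
    (hθ : θ ∈ Set.Icc 0 Real.pi) :
    |dualFun φ ψ I x θ| ≤ (2 : ℝ) ^ I.1 * dualSup φ ψ I.2.2 := by
  obtain ⟨j, k, e⟩ := I
  have hj : (0 : ℝ) < 2 ^ j := by positivity
  have hscale : dualFun φ ψ (j, k, e) x θ = (2 : ℝ) ^ j *
      dualFun φ ψ (0, (0, 0), e) ((2 : ℝ) ^ j * x - (k.1 * Real.cos θ + k.2 * Real.sin θ)) θ := by
    rw [dualFun_eq, dualFun_eq, backKernel_dilate, Complex.re_ofReal_mul]
    simp only [dilate_zero_zero]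
    ring
  rw [hscale, abs_mul, abs_of_pos hj]
  refine mul_le_mul_of_nonneg_left ?_ hj.le
  refine le_csSup ?_ ⟨(_, θ), ⟨Set.mem_univ _, hθ⟩, rfl⟩
  obtain ⟨C, hC⟩ := exists_norm_backKernel_le (hasCubicDecay_firstFactor h e)
    (hasCubicDecay_secondFactor h e)
  refine ⟨|1 / (4 * Real.pi)| * C, ?_⟩
  rintro _ ⟨z, -, rfl⟩
  simp only [dualFun_eq, dilate_zero_zero]
  rw [abs_mul]
  exact mul_le_mul_of_nonneg_left ((Complex.abs_re_le_norm _).trans (hC _ _)) (abs_nonneg _)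

end WaveletPair

/-! ### The Radon transform and the mean of the dual functions -/

/-- Polar coordinates with radii of both signs and angles in a half circle. -/
theorem setIntegral_half_polar (R : ℝ × ℝ → ℂ)
    (hR : IntegrableOn (fun q : ℝ × ℝ => |q.1| • R (q.1 * Real.cos q.2, q.1 * Real.sin q.2))
      (Set.univ ×ˢ Set.Ico 0 Real.pi)) :
    ∫ q in Set.univ ×ˢ Set.Ico 0 Real.pi, |q.1| • R (q.1 * Real.cos q.2, q.1 * Real.sin q.2) =
      ∫ w, R w := by
  set Q : ℝ × ℝ → ℂ := fun q => |q.1| • R (q.1 * Real.cos q.2, q.1 * Real.sin q.2) with hQ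
  -- reversing the sign of the radius is a half turn
  let τ : ℝ × ℝ ≃ᵐ ℝ × ℝ := (MeasurableEquiv.neg ℝ).prodCongr (MeasurableEquiv.subRight Real.pi)
  have hτ : MeasurePreserving τ volume volume :=
    (Measure.measurePreserving_neg volume).prod (measurePreserving_sub_right volume Real.pi)
  have hτQ : ∀ q, Q (τ q) = Q q := by
    intro q
    change |(-q.1)| • R (-q.1 * Real.cos (q.2 - Real.pi), -q.1 * Real.sin (q.2 - Real.pi)) = _
    rw [abs_neg, Real.cos_sub_pi, Real.sin_sub_pi, neg_mul_neg, neg_mul_neg]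
  have hpre : τ ⁻¹' (Set.Ioi 0 ×ˢ Set.Ico (-Real.pi) 0) = Set.Iio 0 ×ˢ Set.Ico 0 Real.pi := by
    ext q
    change (0 < -q.1 ∧ (-Real.pi ≤ q.2 - Real.pi ∧ q.2 - Real.pi < 0)) ↔
      (q.1 < 0 ∧ (0 ≤ q.2 ∧ q.2 < Real.pi))
    constructor <;> rintro ⟨h1, h2, h3⟩ <;> refine ⟨?_, ?_, ?_⟩ <;> linarith
  have hneg : ∫ q in Set.Iio 0 ×ˢ Set.Ico 0 Real.pi, Q q =
      ∫ q in Set.Ioi 0 ×ˢ Set.Ico (-Real.pi) 0, Q q := by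
    rw [← hτ.setIntegral_preimage_emb τ.measurableEmbedding Q (Set.Ioi 0 ×ˢ Set.Ico (-Real.pi) 0),
      hpre]
    simp_rw [hτQ]
  have hnegint : IntegrableOn Q (Set.Ioi 0 ×ˢ Set.Ico (-Real.pi) 0) := by
    rw [← hτ.integrableOn_comp_preimage τ.measurableEmbedding, hpre]
    refine (hR.mono_set (Set.prod_mono (Set.subset_univ _) le_rfl)).congr (ae_of_all _ fun q => ?_)
    exact (hτQ q).symm
  have hposint : IntegrableOn Q (Set.Ioi 0 ×ˢ Set.Ico 0 Real.pi) :=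
    hR.mono_set (Set.prod_mono (Set.subset_univ _) le_rfl)
  have hm1 : MeasurableSet (Set.Ioi (0 : ℝ) ×ˢ Set.Ico 0 Real.pi) :=
    measurableSet_Ioi.prod measurableSet_Ico
  have hsplit : (Set.univ ×ˢ Set.Ico 0 Real.pi : Set (ℝ × ℝ)) =ᵐ[volume]
      (Set.Iio 0 ×ˢ Set.Ico 0 Real.pi ∪ Set.Ioi 0 ×ˢ Set.Ico 0 Real.pi : Set (ℝ × ℝ)) := by
    rw [← Set.union_prod]
    refine Measure.set_prod_ae_eq ?_ Filter.EventuallyEq.rfl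
    rw [Set.Iio_union_Ioi]
    exact (Filter.eventuallyEq_univ.2 (compl_mem_ae_iff.2 (by simp))).symm
  have hjoin : (Set.Ioi 0 ×ˢ Set.Ico (-Real.pi) 0 ∪ Set.Ioi 0 ×ˢ Set.Ico 0 Real.pi : Set (ℝ × ℝ))
      =ᵐ[volume] polarCoord.target := by
    rw [← Set.prod_union, Set.Ico_union_Ico_eq_Ico (by linarith [Real.pi_pos]) Real.pi_pos.le,
      polarCoord_target]
    exact Measure.set_prod_ae_eq Filter.EventuallyEq.rfl Ioo_ae_eq_Ico.symm
  rw [setIntegral_congr_set hsplit, setIntegral_union (Set.disjoint_left.2 ?_) hm1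
    (hR.mono_set (Set.prod_mono (Set.subset_univ _) le_rfl)) hposint, hneg,
    ← setIntegral_union (Set.disjoint_left.2 ?_) hm1 hnegint hposint, setIntegral_congr_set hjoin,
    ← integral_comp_polarCoord_symm]
  · refine setIntegral_congr_fun polarCoord.open_target.measurableSet fun q hq => ?_
    have h0 : 0 < q.1 := by
      rw [polarCoord_target] at hq; exact hq.1
    simp only [hQ, polarCoord_symm_apply, abs_of_pos h0]
  · rintro q ⟨-, h1⟩ ⟨-, h2⟩
    exact absurd h1.2 (not_lt.2 h2.1)
  · rintro q ⟨h1, -⟩ ⟨h2, -⟩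
    exact lt_asymm (Set.mem_Iio.1 h1) (Set.mem_Ioi.1 h2)

/-- Rearrangement `((x, θ), u) ↦ ((u, θ), x)`. -/
theorem measurePreserving_rearrange {μ ν κ : Measure ℝ} [SFinite μ] [SFinite ν] [SFinite κ] :
    MeasurePreserving (fun q : (ℝ × ℝ) × ℝ => ((q.2, q.1.2), q.1.1))
      ((μ.prod ν).prod κ) ((κ.prod ν).prod μ) :=
  ((Measure.measurePreserving_swap (μ := ν) (ν := κ)).prod (MeasurePreserving.id μ)).comp
    (Measure.measurePreserving_swap.comp (measurePreserving_prodAssoc μ ν κ))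

theorem dataLaw_integrable {p : ℝ → ℝ → ℝ} (hp : Measurable fun z : ℝ × ℝ => p z.1 z.2)
    (hp0 : ∀ x θ, 0 ≤ p x θ) [IsProbabilityMeasure (dataLaw p)] :
    IntegrableOn (fun z : ℝ × ℝ => p z.1 z.2 / Real.pi) (Set.univ ×ˢ Set.Ico 0 Real.pi) := by
  have h1 : dataLaw p Set.univ = 1 := measure_univ
  rw [dataLaw, withDensity_apply _ MeasurableSet.univ, Measure.restrict_univ] at h1
  refine (lintegral_ofReal_ne_top_iff_integrable (hp.div_const _).aestronglyMeasurable
    (ae_of_all _ fun z => div_nonneg (hp0 _ _) Real.pi_pos.le)).1 ?_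
  rw [h1]; exact ENNReal.one_ne_top

theorem integral_dataLaw {p : ℝ → ℝ → ℝ} (hp : Measurable fun z : ℝ × ℝ => p z.1 z.2)
    (hp0 : ∀ x θ, 0 ≤ p x θ) (g : ℝ × ℝ → ℝ) :
    ∫ z, g z ∂dataLaw p =
      ∫ z in Set.univ ×ˢ Set.Ico 0 Real.pi, p z.1 z.2 / Real.pi * g z := by
  rw [dataLaw, integral_withDensity_eq_integral_toReal_smul (hp.div_const _).ennreal_ofReal
    (ae_of_all _ fun z => ENNReal.ofReal_lt_top)]
  refine integral_congr_ae (ae_of_all _ fun z => ?_)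
  simp only [smul_eq_mul]
  rw [ENNReal.toReal_ofReal (div_nonneg (hp0 _ _) Real.pi_pos.le)]

theorem ae_dataLaw_mem_Icc (p : ℝ → ℝ → ℝ) : ∀ᵐ z ∂dataLaw p, z.2 ∈ Set.Icc 0 Real.pi := by
  refine (withDensity_absolutelyContinuous _ _).ae_le ?_
  filter_upwards [ae_restrict_mem (MeasurableSet.univ.prod measurableSet_Ico)] with z hz
  exact ⟨hz.2.1, hz.2.2.le⟩

/-- Fourier inversion for tensor products, in the dual form in which the Wigner function is
specified. -/
theorem integral_mul_quantumCharFun {ρ : H →L[ℂ] H} {W : ℝ × ℝ → ℝ} (hW : IsWignerFunction ρ W)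
    {f g : ℝ → ℝ} (hf : HasCubicDecay f) (hg : HasCubicDecay g) :
    ∫ w : ℝ × ℝ, fourier1 f w.1 * fourier1 g w.2 * quantumCharFun ρ (-w) =
      4 * Real.pi ^ 2 * ((∫ z : ℝ × ℝ, W z * (f z.1 * g z.2) : ℝ) : ℂ) := by
  set G : ℝ × ℝ → ℂ := fun w => fourier1 f (-w.1) * fourier1 g (-w.2) with hG
  have hGi : Integrable G :=
    hf.integrable_fourier1.comp_neg.mul_prod hg.integrable_fourier1.comp_neg
  have hG2 : MemLp G 2 (volume : Measure (ℝ × ℝ)) := by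
    rw [← memLp_norm_iff hGi.1, memLp_two_iff_integrable_sq hGi.1.norm]
    refine (hf.integrable_norm_fourier1_sq.comp_neg.mul_prod
      hg.integrable_norm_fourier1_sq.comp_neg).congr (ae_of_all _ fun w => ?_)
    simp only [hG, norm_mul, mul_pow]
  have hinv : ∀ z, fourier2 G z = 4 * Real.pi ^ 2 * ((f z.1 * g z.2 : ℝ) : ℂ) := by
    intro z
    have h1 : ∀ (a : ℝ → ℝ) (x : ℝ),
        ∫ u, fourier1 a (-u) * Complex.exp (-Complex.I * ((x * u : ℝ) : ℂ)) =
          ∫ u, fourier1 a u * Complex.exp (Complex.I * ((x * u : ℝ) : ℂ)) := by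
      intro a x
      rw [← integral_neg_eq_self]
      refine integral_congr_ae (ae_of_all _ fun u => ?_)
      simp only [neg_neg, mul_neg, Complex.ofReal_neg, neg_mul]
    calc fourier2 G z
        = ∫ w : ℝ × ℝ, (fourier1 f (-w.1) * Complex.exp (-Complex.I * ((z.1 * w.1 : ℝ) : ℂ))) *
            (fourier1 g (-w.2) * Complex.exp (-Complex.I * ((z.2 * w.2 : ℝ) : ℂ))) := by
          refine integral_congr_ae (ae_of_all _ fun w => ?_)
          simp only [hG]
          rw [mul_mul_mul_comm, ← Complex.exp_add]
          push_cast
          rw [mul_add]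
      _ = (2 * Real.pi * (f z.1 : ℂ)) * (2 * Real.pi * (g z.2 : ℂ)) := by
          rw [← hf.integral_fourier1_mul_exp, ← hg.integral_fourier1_mul_exp, ← h1, ← h1]
          exact integral_prod_mul
            (fun u => fourier1 f (-u) * Complex.exp (-Complex.I * ((z.1 * u : ℝ) : ℂ)))
            (fun u => fourier1 g (-u) * Complex.exp (-Complex.I * ((z.2 * u : ℝ) : ℂ)))
      _ = _ := by push_cast; ring
  have hdual := hW.fourier G hGi hG2
  calc ∫ w : ℝ × ℝ, fourier1 f w.1 * fourier1 g w.2 * quantumCharFun ρ (-w)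
      = ∫ w : ℝ × ℝ, quantumCharFun ρ w * G w := by
        rw [← integral_neg_eq_self]
        refine integral_congr_ae (ae_of_all _ fun w => ?_)
        simp only [hG, neg_neg, Prod.fst_neg, Prod.snd_neg]
        ring
    _ = ∫ z : ℝ × ℝ, (W z : ℂ) * fourier2 G z := hdual.symm
    _ = ∫ z : ℝ × ℝ, 4 * Real.pi ^ 2 * ((W z * (f z.1 * g z.2) : ℝ) : ℂ) := by
        refine integral_congr_ae (ae_of_all _ fun z => ?_)
        simp only [hinv]
        push_cast; ring
    _ = _ := by rw [integral_const_mul, integral_complex_ofReal]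

/-- The back-projection kernel is integrated against the law of the data by Fubini's theorem: the
integral over `x` gives the Fourier transform of the quadrature density, which is the quantum
characteristic function along a ray, and the remaining integral is one in polar coordinates. -/
theorem integral_dataLaw_backKernel {ρ : H →L[ℂ] H} {W : ℝ × ℝ → ℝ} (hW : IsWignerFunction ρ W)
    {p : ℝ → ℝ → ℝ} (hp : IsQuadratureDensity ρ p) [IsProbabilityMeasure (dataLaw p)]
    {f g : ℝ → ℝ} (hf : HasCubicDecay f) (hg : HasCubicDecay g) :
    ∫ z, (1 / (4 * Real.pi)) * (backKernel f g z.1 z.2).re ∂dataLaw p =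
      ∫ z : ℝ × ℝ, W z * (f z.1 * g z.2) := by
  have hpi : (Real.pi : ℂ) ≠ 0 := by exact_mod_cast Real.pi_ne_zero
  have hdens := dataLaw_integrable hp.measurable hp.nonneg
  set ν : Measure ℝ := volume.restrict (Set.Ico 0 Real.pi) with hν
  have hμ : (volume : Measure (ℝ × ℝ)).restrict (Set.univ ×ˢ Set.Ico 0 Real.pi) =
      (volume : Measure ℝ).prod ν := by
    rw [hν, Measure.volume_eq_prod, ← Measure.prod_restrict, Measure.restrict_univ]
  have hdens' : Integrable (fun z : ℝ × ℝ => p z.1 z.2 / Real.pi)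
      ((volume : Measure ℝ).prod ν) := by
    rw [← hμ]; exact hdens
  -- the joint integrand, in two orders of the variables
  set G : (ℝ × ℝ) × ℝ → ℂ := fun q => ((p q.1.1 q.1.2 / Real.pi : ℝ) : ℂ) *
    (radialKernel f g q.2 q.1.2 * Complex.exp (Complex.I * ((q.1.1 * q.2 : ℝ) : ℂ))) with hG
  set G' : (ℝ × ℝ) × ℝ → ℂ := fun q => ((p q.2 q.1.2 / Real.pi : ℝ) : ℂ) *
    (radialKernel f g q.1.1 q.1.2 * Complex.exp (Complex.I * ((q.2 * q.1.1 : ℝ) : ℂ))) with hG'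
  have hK := (continuous_radialKernel hf.integrable hg.integrable).measurable
  have hGm : Measurable G := by
    refine (Complex.measurable_ofReal.comp ((hp.measurable.comp measurable_fst).div_const _)).mul
      ((hK.comp (measurable_snd.prodMk (measurable_snd.comp measurable_fst))).mul ?_)
    exact (by fun_prop : Continuous fun q : (ℝ × ℝ) × ℝ =>
      Complex.exp (Complex.I * ((q.1.1 * q.2 : ℝ) : ℂ))).measurable
  have hGm' : Measurable G' := by
    refine (Complex.measurable_ofReal.comp ((hp.measurable.comp
      (measurable_snd.prodMk (measurable_snd.comp measurable_fst))).div_const _)).mul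
      ((hK.comp measurable_fst).mul ?_)
    exact (by fun_prop : Continuous fun q : (ℝ × ℝ) × ℝ =>
      Complex.exp (Complex.I * ((q.2 * q.1.1 : ℝ) : ℂ))).measurable
  have hGi : Integrable G (((volume : Measure ℝ).prod ν).prod volume) := by
    obtain ⟨C, hC0, hC⟩ := exists_norm_radialKernel_le hf hg
    refine (hdens'.norm.mul_prod (integrable_inv_one_add_sq.const_mul C)).mono'
      hGm.aestronglyMeasurable (ae_of_all _ fun q => ?_)
    simp only [hG]
    rw [norm_mul, norm_mul, norm_exp_I_mul, mul_one, Complex.norm_real]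
    gcongr
    exact hC _ _
  have hT := measurePreserving_rearrange (μ := (volume : Measure ℝ)) (ν := ν)
    (κ := (volume : Measure ℝ))
  have hGi' : Integrable G' (((volume : Measure ℝ).prod ν).prod volume) :=
    (hT.integrable_comp hGm'.aestronglyMeasurable).1 hGi
  have hGG' : ∫ q, G q ∂(((volume : Measure ℝ).prod ν).prod volume) =
      ∫ q, G' q ∂(((volume : Measure ℝ).prod ν).prod volume) := by
    conv_rhs => rw [← hT.map_eq]
    rw [integral_map hT.measurable.aemeasurable hGm'.aestronglyMeasurable]
  -- the Fourier transform of the quadrature density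
  set R : ℝ × ℝ → ℂ := fun w => fourier1 f w.1 * fourier1 g w.2 * quantumCharFun ρ (-w) with hR
  have hinner : ∀ q : ℝ × ℝ, q.2 ∈ Set.Ico 0 Real.pi → ∫ x, G' (q, x) =
      (1 / Real.pi : ℂ) * |q.1| • R (q.1 * Real.cos q.2, q.1 * Real.sin q.2) := by
    intro q hq
    have hchar := hp.generating q.2 hq q.1
    have hqcf : quantumCharFun ρ (-(q.1 * Real.cos q.2, q.1 * Real.sin q.2)) =
        ∫ x : ℝ, (p x q.2 : ℂ) * Complex.exp (Complex.I * ((q.1 * x : ℝ) : ℂ)) := by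
      rw [hchar, quantumCharFun]
      simp only [Prod.fst_neg, Prod.snd_neg, neg_neg]
    simp only [hR, hqcf]
    rw [Complex.real_smul, ← mul_assoc, ← mul_assoc, ← integral_const_mul]
    refine integral_congr_ae (ae_of_all _ fun x => ?_)
    simp only [hG', radialKernel]
    rw [mul_comm x q.1]
    push_cast; ring
  have hae : ∀ᵐ q ∂((volume : Measure ℝ).prod ν), ∫ x, G' (q, x) =
      (1 / Real.pi : ℂ) * |q.1| • R (q.1 * Real.cos q.2, q.1 * Real.sin q.2) := by
    rw [← hμ]
    filter_upwards [ae_restrict_mem (MeasurableSet.univ.prod measurableSet_Ico)] with q hq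
    exact hinner q hq.2
  have hRi : IntegrableOn (fun q : ℝ × ℝ => |q.1| • R (q.1 * Real.cos q.2, q.1 * Real.sin q.2))
      (Set.univ ×ˢ Set.Ico 0 Real.pi) := by
    rw [IntegrableOn, hμ]
    refine ((hGi'.integral_prod_left.congr hae).const_mul (Real.pi : ℂ)).congr
      (ae_of_all _ fun q => ?_)
    simp only
    rw [← mul_assoc, mul_one_div_cancel hpi, one_mul]
  have htotal : ∫ q, G q ∂(((volume : Measure ℝ).prod ν).prod volume) =
      (1 / Real.pi : ℂ) * (4 * Real.pi ^ 2 * ((∫ z : ℝ × ℝ, W z * (f z.1 * g z.2) : ℝ) : ℂ)) := by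
    rw [hGG', integral_prod _ hGi', integral_congr_ae hae, integral_const_mul, ← hμ,
      setIntegral_half_polar R hRi, hR, integral_mul_quantumCharFun hW hf hg]
  -- the left-hand side is the real part of the same integral
  have hback : ∀ z : ℝ × ℝ, ∫ u, G (z, u) =
      ((p z.1 z.2 / Real.pi : ℝ) : ℂ) * backKernel f g z.1 z.2 := fun z => by
    simp only [hG, backKernel]
    rw [integral_const_mul]
  have hbi : Integrable (fun z : ℝ × ℝ => ((p z.1 z.2 / Real.pi : ℝ) : ℂ) * backKernel f g z.1 z.2)
      ((volume : Measure ℝ).prod ν) := by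
    refine hGi.integral_prod_left.congr (ae_of_all _ fun z => hback z)
  rw [integral_dataLaw hp.measurable hp.nonneg, hμ]
  calc ∫ z : ℝ × ℝ, p z.1 z.2 / Real.pi * (1 / (4 * Real.pi) * (backKernel f g z.1 z.2).re)
        ∂((volume : Measure ℝ).prod ν)
      = 1 / (4 * Real.pi) * ∫ z : ℝ × ℝ, RCLike.re
          (((p z.1 z.2 / Real.pi : ℝ) : ℂ) * backKernel f g z.1 z.2)
            ∂((volume : Measure ℝ).prod ν) := by
        rw [← integral_const_mul]
        refine integral_congr_ae (ae_of_all _ fun z => ?_)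
        simp only [RCLike.re_to_complex, Complex.re_ofReal_mul]
        ring
    _ = 1 / (4 * Real.pi) * (∫ q, G q ∂(((volume : Measure ℝ).prod ν).prod volume)).re := by
        rw [integral_re hbi, integral_prod _ hGi]
        simp only [hback, RCLike.re_to_complex]
    _ = _ := by
        rw [htotal, show (1 / Real.pi : ℂ) * (4 * Real.pi ^ 2 *
          ((∫ z : ℝ × ℝ, W z * (f z.1 * g z.2) : ℝ) : ℂ)) =
          ((4 * Real.pi * (∫ z : ℝ × ℝ, W z * (f z.1 * g z.2)) : ℝ) : ℂ) by
            push_cast; field_simp, Complex.ofReal_re]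
        have := Real.pi_ne_zero
        field_simp

/-- The empirical coefficients are unbiased. -/
theorem integral_dualFun_dataLaw {φ ψ : ℝ → ℝ} (h : IsWaveletPair φ ψ) {ρ : H →L[ℂ] H}
    {W : ℝ × ℝ → ℝ} (hW : IsWignerFunction ρ W) {p : ℝ → ℝ → ℝ} (hp : IsQuadratureDensity ρ p)
    [IsProbabilityMeasure (dataLaw p)] (I : WaveletIndex) :
    ∫ z, dualFun φ ψ I z.1 z.2 ∂dataLaw p = ∫ z, W z * tensorWavelet φ ψ I z := by
  obtain ⟨j, k, e⟩ := I
  simp_rw [dualFun_eq, tensorWavelet_eq]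
  exact integral_dataLaw_backKernel hW hp ((hasCubicDecay_firstFactor h e).dilate j k.1)
    ((hasCubicDecay_secondFactor h e).dilate j k.2)

/-! ### Summability of the weights -/

theorem summable_one_add_abs_int_rpow {b : ℝ} (hb : 1 < b) :
    Summable fun k : ℤ => (1 + |(k : ℝ)|) ^ (-b) := by
  have h0 : Summable fun k : ℤ => if k = 0 then (1 : ℝ) else 0 :=
    summable_of_hasFiniteSupport ((Set.finite_singleton (0 : ℤ)).subset fun k hk => by
      by_contra h; exact hk (if_neg h))
  refine Summable.of_nonneg_of_le (fun k => by positivity) (fun k => ?_)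
    ((Real.summable_abs_int_rpow hb).add h0)
  rcases eq_or_ne k 0 with rfl | hk
  · have : (0 : ℝ) ≤ |((0 : ℤ) : ℝ)| ^ (-b) := by positivity
    simpa using this
  · rw [if_neg hk, add_zero]
    exact Real.rpow_le_rpow_of_nonpos (abs_pos.2 (Int.cast_ne_zero.2 hk)) (by linarith)
      (by linarith)

theorem summable_exp_neg_mul_abs_int {c : ℝ} (hc : 0 < c) :
    Summable fun j : ℤ => Real.exp (-(c * |(j : ℝ)|)) := by
  have h : Summable fun j : ℕ => Real.exp (j * (-c)) :=
    Real.summable_exp_nat_mul_iff.2 (by linarith)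
  refine Summable.of_nat_of_neg (h.congr fun j => ?_) (h.congr fun j => ?_)
  · rw [Int.cast_natCast, Nat.abs_cast]; ring_nf
  · rw [Int.cast_neg, Int.cast_natCast, abs_neg, Nat.abs_cast]; ring_nf

/-- In a bounded region there are of order `2 ^ (2 j)` positions at scale `j`, and `4 < e ^ 2`.
The count is replaced by the weights `(1 + |k|) ^ (-5/4)`, and `2 ^ (5/2) < e ^ 2`. -/
theorem summable_exp_neg_two_mul_scale {D : Set (ℝ × ℝ)} (hD : Bornology.IsBounded D) :
    Summable fun I : {I : WaveletIndex // 0 ≤ I.1 ∧ position I ∈ D} =>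
      Real.exp (-(2 * (I.1.1 : ℝ))) := by
  obtain ⟨R, hR0, hR⟩ := hD.exists_pos_norm_le
  set c : ℝ := 2 - 5 / 2 * Real.log 2 with hc
  have hc0 : 0 < c := by have := Real.log_two_lt_d9; rw [hc]; linarith
  set K : ℝ := (1 + R) ^ (5 / 4 : ℝ) with hK
  set w : ℤ → ℝ := fun k => (1 + |(k : ℝ)|) ^ (-(5 / 4) : ℝ) with hw
  have hw0 : ∀ k, 0 < w k := fun k => by simp only [hw]; positivity
  have hws : Summable w := summable_one_add_abs_int_rpow (by norm_num)
  have hF : Summable fun I : WaveletIndex =>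
      K ^ 2 * (Real.exp (-(c * |(I.1 : ℝ)|)) * ((w I.2.1.1 * w I.2.1.2) * 1)) := by
    refine Summable.mul_left _ ?_
    have h1 : Summable fun k : ℤ × ℤ => w k.1 * w k.2 :=
      hws.mul_of_nonneg hws (fun k => (hw0 k).le) fun k => (hw0 k).le
    have h2 : Summable fun q : (ℤ × ℤ) × Fin 4 => (w q.1.1 * w q.1.2) * (1 : ℝ) :=
      h1.mul_of_nonneg (g := fun _ : Fin 4 => (1 : ℝ)) (hasSum_fintype _).summable
        (fun k => (mul_pos (hw0 _) (hw0 _)).le) fun _ => zero_le_one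
    exact (summable_exp_neg_mul_abs_int hc0).mul_of_nonneg h2 (fun j => (Real.exp_pos _).le)
      fun q => mul_nonneg (mul_pos (hw0 _) (hw0 _)).le zero_le_one
  refine Summable.of_nonneg_of_le (fun I => (Real.exp_pos _).le) ?_
    (hF.comp_injective Subtype.val_injective)
  rintro ⟨⟨j, ⟨kx, ky⟩, e⟩, hj, hpos⟩
  simp only at hj
  simp only [Function.comp_apply, mul_one]
  have hj0 : (0 : ℝ) ≤ (j : ℝ) := by exact_mod_cast hj
  have h2j : (1 : ℝ) ≤ 2 ^ j := one_le_zpow₀ one_le_two hj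
  have hexp : ((2 : ℝ) ^ j) ^ (5 / 4 : ℝ) = Real.exp (5 / 4 * Real.log 2 * j) := by
    rw [← Real.rpow_intCast, ← Real.rpow_mul zero_le_two, Real.rpow_def_of_pos two_pos]
    congr 1; ring
  have hone :
      ∀ k : ℤ, |(2 : ℝ) ^ (-j) * k| ≤ R → 1 ≤ K * Real.exp (5 / 4 * Real.log 2 * j) * w k := by
    intro k hk
    rw [abs_mul, abs_of_pos (by positivity : (0 : ℝ) < 2 ^ (-j)), zpow_neg, inv_mul_le_iff₀
      (by positivity)] at hk
    have h1 : 1 + |(k : ℝ)| ≤ (1 + R) * 2 ^ j := by nlinarith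
    simp only [hw]
    rw [Real.rpow_neg (by positivity), ← div_eq_mul_inv, one_le_div (by positivity), hK, ← hexp,
      ← Real.mul_rpow (by positivity) (by positivity)]
    exact Real.rpow_le_rpow (by positivity) h1 (by norm_num)
  have hx := hone kx ((norm_fst_le (position (j, (kx, ky), e))).trans (hR _ hpos))
  have hy := hone ky ((norm_snd_le (position (j, (kx, ky), e))).trans (hR _ hpos))
  have hxy := one_le_mul_of_one_le_of_one_le hx hy
  rw [abs_of_nonneg hj0]
  calc Real.exp (-(2 * (j : ℝ)))
      ≤ Real.exp (-(2 * (j : ℝ))) * ((K * Real.exp (5 / 4 * Real.log 2 * j) * w kx) *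
          (K * Real.exp (5 / 4 * Real.log 2 * j) * w ky)) :=
        le_mul_of_one_le_right (Real.exp_pos _).le hxy
    _ = K ^ 2 * ((Real.exp (-(2 * (j : ℝ))) * Real.exp (5 / 4 * Real.log 2 * j) *
          Real.exp (5 / 4 * Real.log 2 * j)) * (w kx * w ky)) := by ring
    _ = _ := by
        rw [← Real.exp_add, ← Real.exp_add, hc]
        congr 4; ring

/-! ### The risk bound -/

/-- The contribution of the index `I` to the penalty, without the factor `1 + ε`. -/
noncomputable def indexPenalty (φ ψ : ℝ → ℝ) (α : ℝ) (y : WaveletIndex → ℝ) {n : ℕ}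
    (s : Fin n → ℝ × ℝ) (I : WaveletIndex) : ℝ :=
  1 / n * (2 * devBound α ((2 : ℝ) ^ I.1 * dualSup φ ψ I.2.2) n
    (empMean s (fun x θ => dualFun φ ψ I x θ ^ 2)) (xWeight φ ψ y I) ^ 2)

theorem penalty_eq_sum_indexPenalty (φ ψ : ℝ → ℝ) (ε α : ℝ) (y : WaveletIndex → ℝ) {n : ℕ}
    (s : Fin n → ℝ × ℝ) (m : Finset WaveletIndex) :
    penalty φ ψ ε α y s m = (1 + ε) * ∑ I ∈ m, indexPenalty φ ψ α y s I := by
  unfold penalty indexPenalty devBound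
  rw [Finset.mul_sum, Finset.mul_sum]
  refine Finset.sum_congr rfl fun I _ => ?_
  rw [mul_pow _ (dualSup φ ψ I.2.2), ← zpow_natCast ((2 : ℝ) ^ I.1), ← zpow_mul, mul_comm I.1,
    Nat.cast_ofNat, ← mul_assoc (1 / (n : ℝ)) ((2 : ℝ) ^ (2 * I.1)), div_eq_mul_one_div (1 + ε),
    mul_assoc (1 + ε)]

/-- The oracle inequality before taking expectations; the remainder collects the excess of the
squared deviations over the penalty at all indices. -/
theorem ofReal_loss_sub_le {φ ψ : ℝ → ℝ} (h : IsWaveletPair φ ψ) {ε α : ℝ} (hε : 0 < ε)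
    {y : WaveletIndex → ℝ} {n : ℕ} {D : Set (ℝ × ℝ)} {j₁ j₀ : ℤ} (s : Fin n → ℝ × ℝ)
    {f : ℝ × ℝ → ℝ} (hf : MemLp f 2 (volume : Measure (ℝ × ℝ))) {m' : Finset WaveletIndex}
    (hm' : IsSelected φ ψ ε α y s (models φ ψ y n D j₁ j₀) m') :
    ENNReal.ofReal (max (ε / (2 + ε) * distSq f (projEstimator φ ψ s m') -
        ⨅ m : models φ ψ y n D j₁ j₀,
          ((1 + 2 / ε) * biasSq φ ψ f m + 2 * penalty φ ψ ε α y s m)) 0) ≤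
      ENNReal.ofReal (1 + ε) * ∑' I : allIndices D j₁ j₀, ENNReal.ofReal
        ((empCoeff φ ψ s I - ∫ z, f z * tensorWavelet φ ψ I z) ^ 2 - indexPenalty φ ψ α y s I) := by
  classical
  set β : WaveletIndex → ℝ := fun I => ∫ z, f z * tensorWavelet φ ψ I z with hβ
  set v : WaveletIndex → ℝ :=
    fun I => (empCoeff φ ψ s I - β I) ^ 2 - indexPenalty φ ψ α y s I with hv
  set T := ∑' I : allIndices D j₁ j₀, ENNReal.ofReal (v I) with hT
  rcases eq_or_ne T ⊤ with hTop | hTop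
  · rw [hTop, ENNReal.mul_top (ENNReal.ofReal_pos.2 (by linarith)).ne']
    exact le_top
  rw [← ENNReal.ofReal_toReal hTop, ← ENNReal.ofReal_mul (by linarith)]
  refine ENNReal.ofReal_le_ofReal (max_le ?_ (by positivity))
  have : Nonempty (models φ ψ y n D j₁ j₀) := ⟨⟨m', hm'.1⟩⟩
  rw [sub_le_comm]
  refine le_ciInf fun ⟨m, hm⟩ => ?_
  have hU : ((m ∪ m' : Finset WaveletIndex) : Set WaveletIndex) ⊆ allIndices D j₁ j₀ := by
    rw [Finset.coe_union]; exact Set.union_subset hm.2.1 hm'.1.2.1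
  have hsel := hm'.2 m hm
  rw [empContrast_empCoeff h s hm.2.1, empContrast_empCoeff h s hm'.1.2.1,
    penalty_eq_sum_indexPenalty, penalty_eq_sum_indexPenalty] at hsel
  have horacle := oracle_inequality hε m m' (empCoeff φ ψ s) β (indexPenalty φ ψ α y s)
    (fun I => by unfold indexPenalty; positivity)
    (sum_integral_mul_tensorWavelet_sq_le h hf hU) hsel
  have hrest : ∑ I ∈ m ∪ m', max (v I) 0 ≤ T.toReal := by
    have h1 : ∑ I ∈ m ∪ m', ENNReal.ofReal (v I) ≤ T := by
      rw [hT, tsum_subtype (allIndices D j₁ j₀) fun I => ENNReal.ofReal (v I)]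
      refine le_trans (Finset.sum_le_sum fun I hI => ?_) (ENNReal.sum_le_tsum (m ∪ m'))
      rw [Set.indicator_of_mem (hU hI)]
    have h2 := ENNReal.toReal_mono hTop h1
    rwa [ENNReal.toReal_sum fun I _ => ENNReal.ofReal_ne_top] at h2
  have hbias := le_biasSq h hf hm.2.1
  have hdist := distSq_combination h hf hm'.1.2.1 (empCoeff φ ψ s)
  rw [projEstimator, hdist, penalty_eq_sum_indexPenalty]
  have h1 : (1 + 2 / ε) * ((∫ z, f z ^ 2) - ∑ I ∈ m, β I ^ 2) ≤ (1 + 2 / ε) * biasSq φ ψ f m := by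
    gcongr
  have h2 : (1 + ε) * ∑ I ∈ m ∪ m', max (v I) 0 ≤ (1 + ε) * T.toReal := by gcongr
  simp only at h1 h2 horacle ⊢
  linarith

/-- The choice of `x_I` compensates the growth `2 ^ (2 j)` of the squared bound of `γ_I`. If
`B_e = 0`, then `log B_e` has the junk value `0` and the left-hand side vanishes. -/
theorem sq_bound_mul_exp_neg_xWeight_le (φ ψ : ℝ → ℝ) (y : WaveletIndex → ℝ) {I : WaveletIndex}
    (hI : 0 ≤ I.1) :
    ((2 : ℝ) ^ I.1 * dualSup φ ψ I.2.2) ^ 2 * Real.exp (-xWeight φ ψ y I) ≤ Real.exp (-y I) := by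
  rcases (dualSup_nonneg φ ψ I.2.2).eq_or_lt with h0 | hB
  · rw [← h0, mul_zero, zero_pow two_ne_zero, zero_mul]
    exact (Real.exp_pos _).le
  set B := dualSup φ ψ I.2.2
  have h2 : (2 : ℝ) ^ I.1 ≤ Real.exp I.1 := by
    rw [← mul_one (I.1 : ℝ), mul_comm, Real.exp_mul, Real.rpow_intCast]
    exact zpow_le_zpow_left₀ hI zero_le_two (by linarith [Real.add_one_le_exp (1 : ℝ)])
  have hx : Real.exp (-xWeight φ ψ y I) =
      (Real.exp I.1 ^ 2)⁻¹ * (B ^ 2)⁻¹ * Real.exp (-y I) := by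
    rw [show -xWeight φ ψ y I = -(2 * (I.1 : ℝ)) + -(2 * Real.log B) + -y I by
      simp only [xWeight, B]; ring, Real.exp_add, Real.exp_add, Real.exp_neg, Real.exp_neg]
    congr 3
    · rw [two_mul, Real.exp_add, sq]
    · rw [two_mul, Real.exp_add, Real.exp_log hB, sq]
  rw [hx]
  have hE := Real.exp_pos (I.1 : ℝ)
  calc ((2 : ℝ) ^ I.1 * B) ^ 2 * ((Real.exp I.1 ^ 2)⁻¹ * (B ^ 2)⁻¹ * Real.exp (-y I))
      ≤ (Real.exp I.1 * B) ^ 2 * ((Real.exp I.1 ^ 2)⁻¹ * (B ^ 2)⁻¹ * Real.exp (-y I)) := by gcongr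
    _ = Real.exp (-y I) := by field_simp

/-- The expected excess of one index: the deviation inequality for the sample `γ_I (Y i)`. -/
theorem lintegral_excess_le {φ ψ : ℝ → ℝ} (h : IsWaveletPair φ ψ) {α : ℝ} (hα : 0 < α)
    (hα1 : α < 1) (y : WaveletIndex → ℝ) {n : ℕ} (hn : 1 ≤ n) {ρ : H →L[ℂ] H} {W : ℝ × ℝ → ℝ}
    (hW : IsWignerFunction ρ W) {p : ℝ → ℝ → ℝ} (hp : IsQuadratureDensity ρ p) {Ω : Type*}
    [MeasurableSpace Ω] {P : Measure Ω} [IsProbabilityMeasure P] {Y : Fin n → Ω → ℝ × ℝ}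
    (hY : ∀ i, Measurable (Y i)) (hind : iIndepFun Y P) (hlaw : ∀ i, P.map (Y i) = dataLaw p)
    {I : WaveletIndex} (hI : 0 ≤ I.1) :
    ∫⁻ ω, ENNReal.ofReal ((empCoeff φ ψ (fun i => Y i ω) I - ∫ z, W z * tensorWavelet φ ψ I z) ^ 2 -
        indexPenalty φ ψ α y (fun i => Y i ω) I) ∂P ≤
      ENNReal.ofReal (devConst α / n * Real.exp (-y I)) := by
  have : Nonempty (Fin n) := ⟨⟨0, hn⟩⟩
  have hprob : IsProbabilityMeasure (dataLaw p) := by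
    rw [← hlaw ⟨0, hn⟩]; exact Measure.isProbabilityMeasure_map (hY _).aemeasurable
  have hγ := measurable_dualFun h I
  have hmap : ∀ (g : ℝ × ℝ → ℝ), Measurable g → ∀ i, ∫ ω, g (Y i ω) ∂P = ∫ z, g z ∂dataLaw p :=
    fun g hg i => by rw [← hlaw i, integral_map (hY i).aemeasurable hg.aestronglyMeasurable]
  have key := lintegral_sq_sub_devBound_le (P := P) (x := xWeight φ ψ y I)
    (Z := fun i ω => dualFun φ ψ I (Y i ω).1 (Y i ω).2) hα hα1 (fun i => hγ.comp (hY i))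
    (hind.comp (fun _ z => dualFun φ ψ I z.1 z.2) fun _ => hγ)
    (b := (2 : ℝ) ^ I.1 * dualSup φ ψ I.2.2)
    (fun i => by
      have h1 := ae_dataLaw_mem_Icc p
      rw [← hlaw i] at h1
      filter_upwards [ae_of_ae_map (hY i).aemeasurable h1] with ω hω
      exact abs_dualFun_le h I _ hω)
    (mul_nonneg (by positivity) (dualSup_nonneg φ ψ _))
    (fun i => (hmap _ hγ i).trans (integral_dualFun_dataLaw h hW hp I))
    (fun i => hmap _ (hγ.pow_const 2) i)
  rw [Fintype.card_fin] at key
  refine key.trans (ENNReal.ofReal_le_ofReal ?_)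
  have hd := devConst_nonneg hα hα1
  calc devConst α * (((2 : ℝ) ^ I.1 * dualSup φ ψ I.2.2) ^ 2 / n) * Real.exp (-xWeight φ ψ y I)
      = devConst α / n *
        (((2 : ℝ) ^ I.1 * dualSup φ ψ I.2.2) ^ 2 * Real.exp (-xWeight φ ψ y I)) := by ring
    _ ≤ _ := by
      gcongr
      exact sq_bound_mul_exp_neg_xWeight_le φ ψ y hI

theorem measurable_excess {φ ψ : ℝ → ℝ} (h : IsWaveletPair φ ψ) (α : ℝ) (y : WaveletIndex → ℝ)
    {n : ℕ} {Ω : Type*} [MeasurableSpace Ω] {Y : Fin n → Ω → ℝ × ℝ} (hY : ∀ i, Measurable (Y i))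
    (I : WaveletIndex) (β : ℝ) :
    Measurable fun ω => ENNReal.ofReal ((empCoeff φ ψ (fun i => Y i ω) I - β) ^ 2 -
      indexPenalty φ ψ α y (fun i => Y i ω) I) := by
  have hγ : ∀ i, Measurable fun ω => dualFun φ ψ I (Y i ω).1 (Y i ω).2 := fun i =>
    (measurable_dualFun h I).comp (hY i)
  unfold empCoeff indexPenalty devBound empMean
  fun_prop

theorem mainTheorem5 :
    (∀ D : Set (ℝ × ℝ), Bornology.IsBounded D →
      Summable fun I : {I : WaveletIndex // 0 ≤ I.1 ∧ position I ∈ D} =>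
        Real.exp (-(2 * (I.1.1 : ℝ)))) ∧
    ∀ ε α : ℝ, 0 < ε → 0 < α → α < 1 → ∃ C : ℝ, 0 < C ∧
      ∀ (φ ψ : ℝ → ℝ), IsWaveletPair φ ψ →
      ∀ (D : Set (ℝ × ℝ)), Bornology.IsBounded D →
      ∀ (n : ℕ), 1 ≤ n →
      ∀ (j₁ j₀ : ℤ), 0 ≤ j₁ →
      ∀ (E : Set (ℝ × ℝ)), MeasurableSet E →
        (∀ I ∈ allIndices D j₁ j₀, Function.support (tensorWavelet φ ψ I) ⊆ E) →
      ∀ (ρ : H →L[ℂ] H), IsDensityOperator ρ →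
      ∀ (W : ℝ × ℝ → ℝ), IsWignerFunction ρ W →
      ∀ (p : ℝ → ℝ → ℝ), IsQuadratureDensity ρ p →
      ∀ (y : WaveletIndex → ℝ) (σ : ℝ),
        HasSum (fun I : allIndices D j₁ j₀ => Real.exp (-y I)) σ →
      ∀ (Ω : Type*) [MeasurableSpace Ω] (P : Measure Ω) [IsProbabilityMeasure P]
        (Y : Fin n → Ω → ℝ × ℝ),
        (∀ i, Measurable (Y i)) → iIndepFun Y P → (∀ i, P.map (Y i) = dataLaw p) →
      ∀ (mhat : Ω → Finset WaveletIndex),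
        (∀ ω, IsSelected φ ψ ε α y (fun i => Y i ω) (models φ ψ y n D j₁ j₀) (mhat ω)) →
        ∫⁻ ω, ENNReal.ofReal (max
            (ε / (2 + ε) *
                distSq (E.indicator W) (projEstimator φ ψ (fun i => Y i ω) (mhat ω)) -
              ⨅ m : models φ ψ y n D j₁ j₀,
                ((1 + 2 / ε) * biasSq φ ψ (E.indicator W) m +
                  2 * penalty φ ψ ε α y (fun i => Y i ω) m)) 0) ∂P ≤
          ENNReal.ofReal (C * σ / n + C * (1 / n) * (2 : ℝ) ^ (2 * j₁)) := by
  refine ⟨fun D hD => summable_exp_neg_two_mul_scale hD, fun ε α hε hα hα1 => ?_⟩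
  have hd := devConst_nonneg hα hα1
  refine ⟨(1 + ε) * devConst α + 1, by positivity, ?_⟩
  intro φ ψ h D _ n hn j₁ j₀ hj₁ E hE hsupp ρ _ W hW p hp y σ hσ Ω _ P _ Y hY hind hlaw mhat hsel
  have hscale : ∀ I ∈ allIndices D j₁ j₀, 0 ≤ I.1 := by
    rintro I (hI | hI)
    exacts [hj₁.trans hI.1.ge, hj₁.trans hI.1]
  -- restricting the Wigner function to `E` does not change its coefficients
  have hcoef : ∀ I ∈ allIndices D j₁ j₀, ∫ z, E.indicator W z * tensorWavelet φ ψ I z =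
      ∫ z, W z * tensorWavelet φ ψ I z := by
    intro I hI
    congr 1; ext z
    by_cases hz : z ∈ E
    · rw [Set.indicator_of_mem hz]
    · have : tensorWavelet φ ψ I z = 0 := by
        by_contra hne; exact hz (hsupp I hI hne)
      rw [this, mul_zero, mul_zero]
  have hσ0 : 0 ≤ σ := hσ.nonneg fun I => (Real.exp_pos _).le
  let T : Ω → WaveletIndex → ENNReal := fun ω I => ENNReal.ofReal
    ((empCoeff φ ψ (fun i => Y i ω) I - ∫ z, E.indicator W z * tensorWavelet φ ψ I z) ^ 2 -
      indexPenalty φ ψ α y (fun i => Y i ω) I)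
  have hT : ∀ I, Measurable fun ω => T ω I := fun I =>
    measurable_excess h α y hY I (∫ z, E.indicator W z * tensorWavelet φ ψ I z)
  calc _ ≤ ∫⁻ ω, ENNReal.ofReal (1 + ε) * ∑' I : allIndices D j₁ j₀, T ω I ∂P :=
        lintegral_mono fun ω => ofReal_loss_sub_le h hε _ (hW.memLp.indicator hE) (hsel ω)
    _ = ENNReal.ofReal (1 + ε) * ∑' I : allIndices D j₁ j₀, ∫⁻ ω, T ω I ∂P := by
        rw [lintegral_const_mul' _ _ ENNReal.ofReal_ne_top,
          lintegral_tsum fun I : allIndices D j₁ j₀ => (hT I).aemeasurable]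
    _ ≤ ENNReal.ofReal (1 + ε) *
        ∑' I : allIndices D j₁ j₀, ENNReal.ofReal (devConst α / n * Real.exp (-y I)) := by
        refine mul_le_mul_right (ENNReal.tsum_le_tsum fun I => ?_) _
        simp only [T, hcoef I I.2]
        exact lintegral_excess_le h hα hα1 y hn hW hp hY hind hlaw (hscale I I.2)
    _ = ENNReal.ofReal ((1 + ε) * devConst α * σ / n) := by
        rw [← ENNReal.ofReal_tsum_of_nonneg (fun I => by positivity) (hσ.summable.mul_left _),
          tsum_mul_left, hσ.tsum_eq, ← ENNReal.ofReal_mul (by linarith)]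
        congr 1; ring
    _ ≤ _ := by
        refine ENNReal.ofReal_le_ofReal ?_
        have h1 : (1 + ε) * devConst α * σ / n ≤ ((1 + ε) * devConst α + 1) * σ / n := by
          gcongr; linarith
        have h2 : 0 ≤ ((1 + ε) * devConst α + 1) * (1 / (n : ℝ)) * (2 : ℝ) ^ (2 * j₁) := by
          positivity
        linarith
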